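/- Let $K(z)=\bar z/z^2$ for $z\in\mathbb{C}\setminus\{0\}$, and let $B(z,r)$ denote the closed disc with centre $z$ and radius $r$. There exists a Borel probability measure $\mu$ on $\mathbb{C}$, with closed support $\operatorname{supp}\mu$, such that: (1) $\mu$ is $1$-dimensional, that is, $\mathcal{H}^1(\operatorname{supp}\mu)<\infty$, where $\mathcal{H}^1$ is the one-dimensional Hausdorff measure, and there is a constant $C>0$ with $\mu(B(z,r))\le Cr$ for all $z\in\mathbb{C}$ and $r>0$; (2) $\mu$ is purely unrectifiable, that is, $\mathcal{H}^1(\Gamma\cap\operatorname{supp}\mu)=0$ for every rectifiable curve $\Gamma\subset\mathbb{C}$ (the image of a compact interval under a continuous map of finite length); (3) $T_\mu(1)(z)=\int_{\mathbb{C}}K(z-\xi)\,d\mu(\xi)$ is bounded on $\mathbb{C}\setminus\operatorname{supp}\mu$: there is $M<\infty$ such that for every $z\notin\operatorname{supp}\mu$ this integral converges absolutely and $|T_\mu(1)(z)|\le M$. -/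

import Mathlib

open MeasureTheory Set

/-- The kernel `K(z) = conj z / z ^ 2` on `ℂ \ {0}` (Lean's value at `0` is `0`). -/
noncomputable def tripleKernel (z : ℂ) : ℂ :=
  (starRingEnd ℂ) z / z ^ 2

/-- The singular integral `T_μ(f)(z) = ∫ K(z - ξ) f(ξ) dμ(ξ)`, meant for `z ∉ supp μ`. -/
noncomputable def singularIntegral (K : ℂ → ℂ) (μ : Measure ℂ) (f : ℂ → ℂ) (z : ℂ) : ℂ :=
  ∫ ξ, K (z - ξ) * f ξ ∂μ

/-- A finite Borel measure on `ℂ` is `1`-dimensional if its closed support has finite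
one-dimensional Hausdorff measure and `μ (B(z, r)) ≤ C r` for all closed discs. -/
structure IsOneDimensional (μ : Measure ℂ) : Prop where
  finite : IsFiniteMeasure μ
  hausdorff_support_lt_top : Measure.hausdorffMeasure 1 μ.support < ⊤
  growth : ∃ C : ℝ, 0 < C ∧ ∀ (z : ℂ) (r : ℝ), 0 < r →
    μ (Metric.closedBall z r) ≤ ENNReal.ofReal (C * r)

/-- A rectifiable curve: the image of a compact interval under a continuous map
of finite length. -/
def IsRectifiableCurve (Γ : Set ℂ) : Prop :=
  ∃ (a b : ℝ) (γ : ℝ → ℂ), a ≤ b ∧ ContinuousOn γ (Icc a b) ∧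
    eVariationOn γ (Icc a b) < ⊤ ∧ Γ = γ '' Icc a b

/-- A set is purely unrectifiable if it meets every rectifiable curve in a set of
zero one-dimensional Hausdorff measure. -/
def IsPurelyUnrectifiableSet (E : Set ℂ) : Prop :=
  ∀ Γ : Set ℂ, IsRectifiableCurve Γ → Measure.hausdorffMeasure 1 (Γ ∩ E) = 0

/-- A measure is purely unrectifiable if its closed support is. -/
def IsPurelyUnrectifiable (μ : Measure ℂ) : Prop :=
  IsPurelyUnrectifiableSet μ.support

/-! The source of boundedness is a cancellation: normalized area measure on a disc has zero
potential for K inside that disc. On a circle |ξ| = t one has conj ξ = t²/ξ, so K(u - ξ), or its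
conjugate, is rational in ξ and its average can be computed. Integrating over the radii gives
`discPotential`, which is 0 in the disc and (|z|² - r²)/z³ outside, hence small also just outside
the boundary.

The support is a Cantor set. Each disc of radius R is replaced by N discs of radius R/N, centred at
the points of a lattice of mesh R/k that lie well inside it. Mass equals radius at every level, so
the total radius stays 1 and growth is linear. As N is of order k², the new discs are tiny compared
with their mutual distances: a curve of finite length meets too few of them to carry length, and the
set is purely unrectifiable.

By a Riemann sum estimate (`norm_discPotential_sub_gridPotential_le`), the replacement changes the
potential at w very little, apart from the contribution of the one new disc nearest to w. That
contribution is at most 1 in norm. It is also at most 2⁻ⁿ if w is in or very near a new disc, by the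
cancellation, and if w is not near any old disc, because the new discs are then far away on their
own scale. So a change of order 1 occurs only at the level where w ceases to be near the discs.
Nearness is inherited by coarser levels, so this happens at most once
(`norm_levelPotential_succ_le`), and the potentials of all levels are uniformly bounded. Off the
support the level potentials approximate T_μ(1), which inherits the bound. -/

/-! ### Averages of the kernel over circles -/

open Real in
/-- Integration over `ℂ` in terms of circle averages. -/
theorem integral_eq_integral_circleAverage {f : ℂ → ℂ} (hm : Measurable f) (hf : Integrable f) :
    ∫ z, f z = ∫ t in Ioi (0 : ℝ), (2 * π * t) • circleAverage f 0 t := by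
  have hsymm : Measurable fun p : ℝ × ℝ => Complex.polarCoord.symm p := by
    simp only [Complex.polarCoord_symm_apply]
    fun_prop
  have hint : IntegrableOn (fun p : ℝ × ℝ => p.1 • f (Complex.polarCoord.symm p))
      polarCoord.target := by
    refine ⟨((measurable_fst.smul (hm.comp hsymm)).aestronglyMeasurable), ?_⟩
    have h := hf.2
    rw [HasFiniteIntegral, ← Complex.lintegral_comp_polarCoord_symm] at h
    refine lt_of_le_of_lt (le_of_eq ?_) h
    refine setLIntegral_congr_fun polarCoord.open_target.measurableSet ?_
    intro p hp
    have hp0 : 0 < p.1 := by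
      rw [polarCoord_target] at hp
      exact hp.1
    simp only [enorm_smul, smul_eq_mul]
    rw [Real.enorm_of_nonneg hp0.le]
  rw [← Complex.integral_comp_polarCoord_symm]
  rw [polarCoord_target] at hint ⊢
  rw [Measure.volume_eq_prod] at hint ⊢
  rw [setIntegral_prod _ hint]
  refine setIntegral_congr_fun measurableSet_Ioi fun t ht => ?_
  simp only
  rw [integral_smul, circleAverage_def, smul_smul]
  have h2 : (2 * π * t) * (2 * π)⁻¹ = t := by field_simp
  rw [h2]
  congr 1
  have hper : Function.Periodic (fun θ : ℝ => f (circleMap 0 t θ)) (2 * π) := by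
    intro θ
    simp only [periodic_circleMap 0 t θ]
  have := hper.intervalIntegral_add_eq (-π) 0
  rw [zero_add, show -π + 2 * π = π by ring] at this
  rw [← this, intervalIntegral.integral_of_le (by linarith [pi_pos]),
    ← integral_Ioc_eq_integral_Ioo]
  refine setIntegral_congr_fun measurableSet_Ioc fun θ _ => ?_
  simp only [Complex.polarCoord_symm_apply, circleMap, zero_add, Complex.exp_mul_I,
    Complex.ofReal_cos, Complex.ofReal_sin]

theorem norm_tripleKernel (z : ℂ) : ‖tripleKernel z‖ = ‖z‖⁻¹ := by
  rcases eq_or_ne z 0 with rfl | hz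
  · simp [tripleKernel]
  · have : ‖z‖ ≠ 0 := norm_ne_zero_iff.2 hz
    simp only [tripleKernel, norm_div, norm_pow, RCLike.norm_conj]
    field_simp

theorem measurable_tripleKernel : Measurable tripleKernel := by
  unfold tripleKernel
  exact (Complex.continuous_conj.measurable).div (measurable_id.pow_const 2)

open Real in
/-- Inside the circle, the average of the kernel over the circle vanishes. -/
theorem circleAverage_tripleKernel_of_lt {u : ℂ} {t : ℝ} (h : ‖u‖ < t) :
    circleAverage (fun ξ => tripleKernel (u - ξ)) 0 t = 0 := by
  have ht : 0 < t := (norm_nonneg u).trans_lt h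
  -- On the circle, ξ · conj ξ = t² turns the conjugate of K(u - ξ) into `g`. Its denominator has no
  -- zero in the closed disc, so the average is the value at the centre, g 0 = 0.
  set g : ℂ → ℂ := fun ξ => (u - ξ) * ξ ^ 2 / (starRingEnd ℂ u * ξ - t ^ 2) ^ 2 with hg
  have hne : ∀ ξ ∈ Metric.closedBall (0 : ℂ) |t|, (starRingEnd ℂ u * ξ - t ^ 2) ≠ 0 := by
    intro ξ hξ h0
    rw [abs_of_pos ht, mem_closedBall_zero_iff] at hξ
    have h1 : ‖starRingEnd ℂ u * ξ‖ = t ^ 2 := by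
      rw [sub_eq_zero.1 h0]; simp
    rw [norm_mul, RCLike.norm_conj] at h1
    nlinarith [norm_nonneg u, norm_nonneg ξ]
  have hd : DifferentiableOn ℂ g (Metric.closedBall 0 |t|) := by
    refine DifferentiableOn.div (by fun_prop) (by fun_prop) fun ξ hξ => pow_ne_zero 2 (hne ξ hξ)
  have hav : circleAverage g 0 t = 0 := by
    rw [(hd.mono Metric.closure_ball_subset_closedBall).diffContOnCl.circleAverage]
    simp [hg]
  have hci : CircleIntegrable g 0 t :=
    (hd.continuousOn.mono Metric.sphere_subset_closedBall).circleIntegrable'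
  have key := (Complex.conjCLE : ℂ →L[ℝ] ℂ).circleAverage_comp_comm hci
  rw [hav, map_zero] at key
  refine Eq.trans ?_ key
  refine circleAverage_congr_sphere (E := ℂ) fun ξ hξ => ?_
  rw [abs_of_pos ht, mem_sphere_zero_iff_norm] at hξ
  have hξ0 : ξ ≠ 0 := by rintro rfl; simp at hξ; linarith
  have hmul : ξ * starRingEnd ℂ ξ = t ^ 2 := by
    rw [Complex.mul_conj, Complex.normSq_eq_norm_sq, hξ]; simp
  have hc0 : starRingEnd ℂ ξ ≠ 0 := by simpa using hξ0
  have hu : u - ξ ≠ 0 := by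
    intro h0
    rw [sub_eq_zero.1 h0] at h
    linarith
  have h3 : u * starRingEnd ℂ ξ - t ^ 2 = (u - ξ) * starRingEnd ℂ ξ := by
    rw [← hmul]; ring
  simp [hg, tripleKernel, h3]
  field_simp

-- With conj ξ = t²/ξ the kernel becomes conj u · g - t² · g/ξ, where g = (u - ξ)⁻² is holomorphic
-- on the closed disc. The first average is g(0) by the mean value property, the second is g'(0) by
-- Cauchy's formula.
open Real in
theorem circleAverage_tripleKernel_of_gt {u : ℂ} {t : ℝ} (ht : 0 < t) (h : t < ‖u‖) :
    circleAverage (fun ξ => tripleKernel (u - ξ)) 0 t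
      = starRingEnd ℂ u / u ^ 2 - 2 * t ^ 2 / u ^ 3 := by
  set g : ℂ → ℂ := fun ξ => ((u - ξ) ^ 2)⁻¹ with hg
  have hne : ∀ ξ ∈ Metric.closedBall (0 : ℂ) t, u - ξ ≠ 0 := by
    intro ξ hξ h0
    rw [mem_closedBall_zero_iff, ← sub_eq_zero.1 h0] at hξ
    linarith
  have hu0 : u ≠ 0 := by rintro rfl; simp at h; linarith
  have hd : DifferentiableOn ℂ g (Metric.closedBall 0 t) := by
    refine DifferentiableOn.inv (by fun_prop) fun ξ hξ => pow_ne_zero 2 (hne ξ hξ)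
  have hav : circleAverage g 0 t = (u ^ 2)⁻¹ := by
    rw [DiffContOnCl.circleAverage
      (((abs_of_pos ht).symm ▸ hd).mono Metric.closure_ball_subset_closedBall).diffContOnCl]
    simp [hg]
  have hderiv : deriv g 0 = 2 / u ^ 3 := by
    have h1 : HasDerivAt (fun ξ : ℂ => (u - ξ) ^ 2) (-2 * u) 0 := by
      have := ((hasDerivAt_const (0 : ℂ) u).sub (hasDerivAt_id (0 : ℂ))).pow 2
      convert! this using 1
      simp
    have h2 := h1.inv (by simpa using hu0)
    rw [show g = (fun ξ : ℂ => (u - ξ) ^ 2)⁻¹ from rfl, HasDerivAt.deriv h2]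
    simp
    field_simp
  have hcg : ContinuousOn g (Metric.sphere 0 |t|) := by
    rw [abs_of_pos ht]
    exact hd.continuousOn.mono Metric.sphere_subset_closedBall
  have hcg' : ContinuousOn (fun ξ => ξ⁻¹ * g ξ) (Metric.sphere 0 |t|) := by
    refine ContinuousOn.mul (continuousOn_id.inv₀ fun ξ hξ => ?_) hcg
    rw [mem_sphere_zero_iff_norm, abs_of_pos ht] at hξ
    rintro h0
    simp only [id] at h0
    rw [h0, norm_zero] at hξ
    linarith
  have hav2 : circleAverage (fun ξ => ξ⁻¹ * g ξ) 0 t = 2 / u ^ 3 := by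
    rw [circleAverage_eq_circleIntegral ht.ne']
    have := hd.deriv_eq_smul_circleIntegral ht
    rw [hderiv] at this
    have h2 : (∮ z in C(0, t), (z - 0)⁻¹ • (z⁻¹ * g z))
        = ∮ z in C(0, t), (1 / (z - 0) ^ 2) • g z := by
      congr 1
      ext z
      simp only [sub_zero, smul_eq_mul]
      rw [← mul_assoc]
      congr 1
      rw [one_div, sq, mul_inv]
    rw [h2, this, smul_smul, inv_mul_cancel₀ Complex.two_pi_I_ne_zero, one_smul]
  have heq : circleAverage (fun ξ => tripleKernel (u - ξ)) 0 t
      = circleAverage (fun ξ => starRingEnd ℂ u • g ξ - (t ^ 2 : ℂ) • (ξ⁻¹ * g ξ)) 0 t := by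
    refine circleAverage_congr_sphere fun ξ hξ => ?_
    rw [abs_of_pos ht, mem_sphere_zero_iff_norm] at hξ
    have hξ0 : ξ ≠ 0 := by rintro rfl; simp at hξ; linarith
    have hmul : starRingEnd ℂ ξ = t ^ 2 * ξ⁻¹ := by
      rw [eq_mul_inv_iff_mul_eq₀ hξ0, mul_comm, Complex.mul_conj, Complex.normSq_eq_norm_sq, hξ]
      simp
    simp only [tripleKernel, map_sub, hmul, hg, smul_eq_mul]
    ring
  rw [heq, circleAverage_fun_sub, circleAverage_fun_smul, circleAverage_fun_smul, hav, hav2]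
  · simp only [smul_eq_mul]; ring
  · exact ContinuousOn.circleIntegrable'
      (hcg.const_smul (starRingEnd ℂ u) : ContinuousOn (fun ξ => starRingEnd ℂ u • g ξ) _)
  · exact ContinuousOn.circleIntegrable'
      (hcg'.const_smul (t ^ 2 : ℂ) : ContinuousOn (fun ξ => (t ^ 2 : ℂ) • (ξ⁻¹ * g ξ)) _)

/-! ### Integrability of the kernel against area -/

open Real in
theorem integrableOn_inv_norm_closedBall_zero (η : ℝ) :
    IntegrableOn (fun ξ : ℂ => ‖ξ‖⁻¹) (Metric.closedBall 0 η) := by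
  refine IntegrableOn.mono_set ?_ (Metric.closedBall_subset_ball (lt_add_one η))
  refine (integrableOn_fun_norm_addHaar (volume : Measure ℂ) (f := fun t => t⁻¹)).2 ?_
  refine IntegrableOn.congr_fun (f := fun _ => (1 : ℝ)) (by simp) ?_ measurableSet_Ioo
  intro t ht
  have := ht.1.ne'
  simp [Complex.finrank_real_complex]
  field_simp

open Real in
theorem setIntegral_inv_norm_closedBall_zero {η : ℝ} (hη : 0 ≤ η) :
    ∫ ξ in Metric.closedBall (0 : ℂ) η, ‖ξ‖⁻¹ = 2 * π * η := by
  rw [← integral_indicator Metric.isClosed_closedBall.measurableSet]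
  have h1 : (fun ξ : ℂ => (Metric.closedBall (0 : ℂ) η).indicator (fun ξ => ‖ξ‖⁻¹) ξ)
      = fun ξ => (Iic η).indicator (fun t => t⁻¹) ‖ξ‖ := by
    ext ξ
    simp [indicator]
  rw [h1, integral_fun_norm_addHaar]
  have h2 : ∫ y in Ioi (0 : ℝ), y ^ (Module.finrank ℝ ℂ - 1) • (Iic η).indicator (fun t => t⁻¹) y
      = ∫ y in Ioi (0 : ℝ), (Ioc 0 η).indicator (fun _ => (1 : ℝ)) y := by
    refine setIntegral_congr_fun measurableSet_Ioi fun t ht => ?_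
    have : t ≠ 0 := (mem_Ioi.1 ht).ne'
    have : 0 < t := ht
    by_cases h : t ≤ η <;> simp [indicator, h, Complex.finrank_real_complex]; grind
  rw [h2, setIntegral_indicator measurableSet_Ioc, inter_eq_right.2 Ioc_subset_Ioi_self]
  simp [Complex.finrank_real_complex, measureReal_def, hη]
  ring

theorem integrableOn_inv_norm_sub_closedBall (u : ℂ) (η : ℝ) :
    IntegrableOn (fun ξ : ℂ => ‖u - ξ‖⁻¹) (Metric.closedBall u η) := by
  have h := integrableOn_inv_norm_closedBall_zero η
  have hp := (Measure.measurePreserving_sub_left volume u)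
  rw [← hp.integrableOn_comp_preimage (Homeomorph.subLeft u).measurableEmbedding] at h
  convert! h using 1
  ext ξ
  simp [dist_eq_norm, norm_sub_rev]

open Real in
theorem setIntegral_inv_norm_sub_closedBall (u : ℂ) {η : ℝ} (hη : 0 ≤ η) :
    ∫ ξ in Metric.closedBall u η, ‖u - ξ‖⁻¹ = 2 * π * η := by
  rw [← setIntegral_inv_norm_closedBall_zero hη]
  have hp := (Measure.measurePreserving_sub_left (volume : Measure ℂ) u)
  rw [← hp.setIntegral_preimage_emb (Homeomorph.subLeft u).measurableEmbedding]
  have : (fun ξ => u - ξ) ⁻¹' Metric.closedBall u η = Metric.closedBall 0 η := by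
    ext ξ
    simp [dist_eq_norm]
  simp [this]

theorem integrableOn_inv_norm_sub (u : ℂ) {s : Set ℂ} (hs : Bornology.IsBounded s) :
    IntegrableOn (fun ξ : ℂ => ‖u - ξ‖⁻¹) s := by
  obtain ⟨R, hR⟩ := hs.subset_closedBall u
  exact (integrableOn_inv_norm_sub_closedBall u R).mono_set hR

theorem integrableOn_tripleKernel_sub (u : ℂ) {s : Set ℂ} (hs : Bornology.IsBounded s) :
    IntegrableOn (fun ξ : ℂ => tripleKernel (u - ξ)) s := by
  refine Integrable.mono (integrableOn_inv_norm_sub u hs)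
    (measurable_tripleKernel.comp (measurable_const.sub measurable_id)).aestronglyMeasurable ?_
  refine Filter.Eventually.of_forall fun ξ => ?_
  simp [norm_tripleKernel]

/-! ### The potential of a disc and kernel estimates -/

/-- The potential of the disc `B(0, r)` with normalized area measure. -/
noncomputable def discPotential (r : ℝ) (z : ℂ) : ℂ :=
  if ‖z‖ ≤ r then 0 else ((‖z‖ ^ 2 - r ^ 2 : ℝ) : ℂ) / z ^ 3

open Real in
/-- The potential of the unit disc vanishes inside the disc. -/
theorem setIntegral_tripleKernel_unitDisc (u : ℂ) :
    ∫ ξ in Metric.closedBall (0 : ℂ) 1, tripleKernel (u - ξ) = π * discPotential 1 u := by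
  have hmK : Measurable fun ξ => tripleKernel (u - ξ) :=
    measurable_tripleKernel.comp (measurable_const.sub measurable_id)
  have hball := (Metric.isClosed_closedBall (x := (0 : ℂ)) (ε := 1)).measurableSet
  rw [← integral_indicator hball, integral_eq_integral_circleAverage (hmK.indicator hball)
    ((integrableOn_tripleKernel_sub u Metric.isBounded_closedBall).integrable_indicator hball)]
  -- Circles of radius above |u| average to zero, and those of radius above 1 miss the disc.
  set m : ℝ := min 1 ‖u‖ with hm
  have hm0 : 0 ≤ m := le_min zero_le_one (norm_nonneg u)
  set A : ℂ := starRingEnd ℂ u / u ^ 2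
  set B : ℂ := 2 / u ^ 3
  have hav : ∀ᵐ t : ℝ, t ∈ Ioi (0 : ℝ) → (2 * π * t) • circleAverage
      ((Metric.closedBall 0 1).indicator fun ξ => tripleKernel (u - ξ)) 0 t
      = (Ioc 0 m).indicator (fun t : ℝ => (2 * π : ℂ) * (A * t - B * t ^ 3)) t := by
    filter_upwards [compl_mem_ae_iff.2 (measure_singleton ‖u‖)] with t htu ht
    have htu : t ≠ ‖u‖ := htu
    have ht : 0 < t := ht
    by_cases h1 : t ≤ 1
    · have : circleAverage ((Metric.closedBall 0 1).indicator fun ξ => tripleKernel (u - ξ)) 0 t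
          = circleAverage (fun ξ => tripleKernel (u - ξ)) 0 t := by
        refine circleAverage_congr_sphere (E := ℂ) fun ξ hξ => ?_
        rw [abs_of_pos ht, mem_sphere_zero_iff_norm] at hξ
        simp [indicator, hξ, h1]
      rw [this]
      rcases lt_or_gt_of_ne htu with h2 | h2
      · rw [circleAverage_tripleKernel_of_gt ht h2,
          indicator_of_mem (show t ∈ Ioc 0 m from ⟨ht, le_min h1 h2.le⟩)]
        simp only [A, B, Complex.real_smul]
        push_cast
        ring
      · rw [circleAverage_tripleKernel_of_lt h2, indicator_of_notMem, smul_zero]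
        intro h3
        exact absurd (h3.2.trans (min_le_right _ _)) (not_le.2 h2)
    · have : circleAverage ((Metric.closedBall 0 1).indicator fun ξ => tripleKernel (u - ξ)) 0 t
          = circleAverage (fun _ => 0) 0 t := by
        refine circleAverage_congr_sphere (E := ℂ) fun ξ hξ => ?_
        rw [abs_of_pos ht, mem_sphere_zero_iff_norm] at hξ
        simp [indicator, hξ, h1]
      rw [this, circleAverage_const, smul_zero, indicator_of_notMem]
      intro h3
      exact h1 (h3.2.trans (min_le_left _ _))
  rw [setIntegral_congr_ae measurableSet_Ioi hav, setIntegral_indicator measurableSet_Ioc,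
    inter_eq_right.2 Ioc_subset_Ioi_self, ← intervalIntegral.integral_of_le hm0]
  have hder : ∀ t ∈ uIcc 0 m, HasDerivAt
      (fun t : ℝ => (2 * π : ℂ) * (A * (t ^ 2 / 2) - B * (t ^ 4 / 4)))
      ((2 * π : ℂ) * (A * t - B * t ^ 3)) t := by
    intro t _
    have h0 : HasDerivAt (fun t : ℝ => (t : ℂ)) 1 t := Complex.ofRealCLM.hasDerivAt
    have h := (((h0.pow 2).div_const 2).const_mul A).sub (((h0.pow 4).div_const 4).const_mul B)
    convert! h.const_mul (2 * π : ℂ) using 1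
    push_cast
    ring
  rw [intervalIntegral.integral_eq_sub_of_hasDerivAt hder
    (Continuous.intervalIntegrable (by fun_prop) _ _)]
  rcases eq_or_ne u 0 with rfl | hu
  · simp [A, B, discPotential]
  have hmul : u * starRingEnd ℂ u = (‖u‖ : ℂ) ^ 2 := by
    rw [Complex.mul_conj, Complex.normSq_eq_norm_sq]; simp
  have hA : A = (‖u‖ : ℂ) ^ 2 / u ^ 3 := by
    rw [← hmul]; simp only [A]; field_simp
  unfold discPotential
  split_ifs with h
  -- The cancellation: at m = |u| both terms of the antiderivative equal |u|⁴/(2u³).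
  · rw [hm, min_eq_right h, hA]
    simp only [B]
    push_cast
    field_simp
    ring
  · rw [hm, min_eq_left (not_le.1 h).le, hA]
    simp only [B]
    push_cast
    field_simp
    ring

theorem norm_discPotential_le {r : ℝ} (hr : 0 ≤ r) (z : ℂ) : ‖discPotential r z‖ ≤ ‖z‖⁻¹ := by
  unfold discPotential
  split_ifs with h
  · simp
  · have h := not_le.1 h
    have hz : 0 < ‖z‖ := hr.trans_lt h
    rw [norm_div, norm_pow, Complex.norm_real, Real.norm_of_nonneg (by nlinarith),
      div_le_iff₀ (by positivity)]
    have : ‖z‖⁻¹ * ‖z‖ ^ 3 = ‖z‖ ^ 2 := by field_simp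
    rw [this]
    nlinarith

theorem norm_discPotential_sub_tripleKernel {r : ℝ} (hr : 0 ≤ r) {z : ℂ} (h : r < ‖z‖) :
    ‖discPotential r z - tripleKernel z‖ = r ^ 2 / ‖z‖ ^ 3 := by
  have hz : z ≠ 0 := norm_pos_iff.1 (hr.trans_lt h)
  have hmul : (starRingEnd ℂ z) = (‖z‖ : ℂ) ^ 2 / z := by
    rw [eq_div_iff hz, mul_comm, Complex.mul_conj, Complex.normSq_eq_norm_sq]; simp
  have : discPotential r z - tripleKernel z = -((r ^ 2 : ℝ) : ℂ) / z ^ 3 := by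
    rw [discPotential, if_neg (not_le.2 h), tripleKernel, hmul]
    push_cast
    field_simp
    ring
  rw [this, norm_div, norm_neg, Complex.norm_real, Real.norm_of_nonneg (sq_nonneg r), norm_pow]

/-- The factor |z| - 1 in |z|² - 1 gives first-order vanishing at the boundary; this controls the
potential in a slight enlargement of a disc. -/
theorem norm_discPotential_one_le {z : ℂ} {δ : ℝ} (hδ : 0 ≤ δ) (h : ‖z‖ ≤ 1 + δ) :
    ‖discPotential 1 z‖ ≤ 2 * δ := by
  unfold discPotential
  split_ifs with h1
  · simpa using hδ
  · have h1 := not_le.1 h1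
    rw [norm_div, norm_pow, Complex.norm_real, Real.norm_of_nonneg (by nlinarith),
      div_le_iff₀ (by positivity)]
    have h2 : ‖z‖ ^ 2 - 1 ^ 2 ≤ δ * (‖z‖ + 1) := by nlinarith
    have h3 : ‖z‖ + 1 ≤ 2 * ‖z‖ ^ 3 := by nlinarith [sq_nonneg (‖z‖ - 1), sq_nonneg ‖z‖]
    nlinarith

theorem norm_discPotential_one_le_one (z : ℂ) : ‖discPotential 1 z‖ ≤ 1 := by
  by_cases h : ‖z‖ ≤ 1
  · simp [discPotential, h]
  · exact (norm_discPotential_le zero_le_one z).trans (inv_le_one_of_one_le₀ (not_le.1 h).le)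

/-- Homogeneity of degree -1. Since the mass of each disc equals its radius, its contribution
depends only on the rescaled position. -/
theorem discPotential_mul {a : ℝ} (ha : 0 < a) (r : ℝ) (z : ℂ) :
    discPotential (a * r) (a * z) = (a : ℂ)⁻¹ * discPotential r z := by
  have ha' : (a : ℂ) ≠ 0 := by exact_mod_cast ha.ne'
  unfold discPotential
  rw [norm_mul, Complex.norm_real, Real.norm_of_nonneg ha.le]
  by_cases h : ‖z‖ ≤ r
  · rw [if_pos h, if_pos (mul_le_mul_of_nonneg_left h ha.le), mul_zero]
  · rw [if_neg h, if_neg (fun h' => h (le_of_mul_le_mul_left h' ha))]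
    push_cast
    rcases eq_or_ne z 0 with rfl | hz
    · simp
    field_simp

theorem norm_tripleKernel_sub_le {x y : ℂ} (hx : x ≠ 0) (hy : y ≠ 0) :
    ‖tripleKernel x - tripleKernel y‖ ≤ ‖x - y‖ * (2 * ‖y‖ + ‖x‖) / (‖x‖ ^ 2 * ‖y‖) := by
  have h : tripleKernel x - tripleKernel y
      = (starRingEnd ℂ (x - y) * y ^ 2 - starRingEnd ℂ y * ((x - y) * (x + y)))
        / (x ^ 2 * y ^ 2) := by
    simp only [tripleKernel, map_sub]
    field_simp
    ring
  have hx' := norm_pos_iff.2 hx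
  have hy' := norm_pos_iff.2 hy
  rw [h, norm_div, div_le_div_iff₀ (by simp; positivity) (by positivity)]
  have h1 : ‖starRingEnd ℂ (x - y) * y ^ 2 - starRingEnd ℂ y * ((x - y) * (x + y))‖
      ≤ ‖x - y‖ * ‖y‖ * (2 * ‖y‖ + ‖x‖) := by
    refine (norm_sub_le _ _).trans ?_
    simp only [norm_mul, norm_pow, RCLike.norm_conj]
    have := norm_add_le x y
    nlinarith [mul_nonneg (norm_nonneg (x - y)) hy'.le,
      mul_le_mul_of_nonneg_left this (mul_nonneg (norm_nonneg (x - y)) hy'.le)]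
  refine (mul_le_mul_of_nonneg_right h1 (by positivity)).trans (le_of_eq ?_)
  rw [norm_mul, norm_pow, norm_pow]
  ring

/-- Integral bound for a function dominated by `a / |u - ξ|` near `u` and by `b` elsewhere. -/
theorem norm_setIntegral_le_near_far {f : ℂ → ℂ} {U : Set ℂ} (hU : MeasurableSet U)
    (hfin : volume U ≠ ⊤) (u : ℂ) {η a b : ℝ} (hη : 0 ≤ η) (ha : 0 ≤ a) (hb : 0 ≤ b)
    (hnear : ∀ ξ ∈ U, u - ξ ≠ 0 → ‖u - ξ‖ ≤ η → ‖f ξ‖ ≤ a * ‖u - ξ‖⁻¹)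
    (hfar : ∀ ξ ∈ U, η < ‖u - ξ‖ → ‖f ξ‖ ≤ b) :
    ‖∫ ξ in U, f ξ‖ ≤ 2 * Real.pi * η * a + b * volume.real U := by
  set D := Metric.closedBall u η with hD
  have hDm : MeasurableSet D := Metric.isClosed_closedBall.measurableSet
  set h : ℂ → ℝ := D.indicator fun ξ => a * ‖u - ξ‖⁻¹ with hh
  have hint : Integrable h :=
    IntegrableOn.integrable_indicator ((integrableOn_inv_norm_sub_closedBall u η).const_mul a) hDm
  have hpos : 0 ≤ h := fun ξ => indicator_nonneg (fun _ _ => by positivity) ξ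
  have hbint : IntegrableOn (fun _ : ℂ => b) U := integrableOn_const hfin
  calc ‖∫ ξ in U, f ξ‖ ≤ ∫ ξ in U, (h ξ + b) := by
        refine norm_integral_le_of_norm_le (hint.integrableOn.add hbint) ?_
        filter_upwards [ae_restrict_mem hU,
          ae_restrict_of_ae (compl_mem_ae_iff.2 (measure_singleton u))] with ξ hξ hξu
        have hξu : u - ξ ≠ 0 := sub_ne_zero.2 (Ne.symm hξu)
        by_cases hn : ‖u - ξ‖ ≤ η
        · have : ξ ∈ D := by rwa [hD, Metric.mem_closedBall, dist_comm, dist_eq_norm]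
          simp only [hh, indicator_of_mem this]
          linarith [hnear ξ hξ hξu hn]
        · linarith [hfar ξ hξ (not_le.1 hn), hpos ξ, show (0 : ℂ → ℝ) ξ = 0 from rfl]
    _ = (∫ ξ in U, h ξ) + b * volume.real U := by
        rw [integral_add hint.integrableOn hbint, setIntegral_const, smul_eq_mul, mul_comm b]
    _ ≤ (∫ ξ, h ξ) + b * volume.real U := by
        have := setIntegral_le_integral (s := U) hint (Filter.Eventually.of_forall hpos)
        linarith
    _ = _ := by
        rw [hh, integral_indicator hDm, integral_const_mul, setIntegral_inv_norm_sub_closedBall u hη]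
        ring

/-! ### Lattice points in the disc and their cells -/

/-- The lattice point `(a + i b) / k`. -/
noncomputable def gridPoint (k : ℕ) (p : ℤ × ℤ) : ℂ := ⟨p.1 / k, p.2 / k⟩

/-- The lower left corner of the lattice square containing `ξ`. -/
noncomputable def gridCorner (k : ℕ) (ξ : ℂ) : ℂ := gridPoint k (⌊k * ξ.re⌋, ⌊k * ξ.im⌋)

open Classical in
/-- The points of the lattice `k⁻¹ ℤ[i]` in the disc of radius `1 - 3 / k`. -/
noncomputable def grid (k : ℕ) : Finset ℂ :=
  ((Finset.Icc (-(k : ℤ)) k ×ˢ Finset.Icc (-(k : ℤ)) k).image (gridPoint k)).filter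
    fun s => ‖s‖ ≤ 1 - 3 / k

theorem gridPoint_injective {k : ℕ} (hk : 0 < k) : Function.Injective (gridPoint k) := by
  rintro ⟨a, b⟩ ⟨c, d⟩ h
  have hk' : (k : ℝ) ≠ 0 := by positivity
  have h1 := congrArg Complex.re h
  have h2 := congrArg Complex.im h
  simp only [gridPoint] at h1 h2
  rw [div_left_inj' hk'] at h1 h2
  simp only [Prod.mk.injEq]
  exact ⟨by exact_mod_cast h1, by exact_mod_cast h2⟩

theorem mem_grid {k : ℕ} (hk : 0 < k) {s : ℂ} :
    s ∈ grid k ↔ (∃ p, gridPoint k p = s) ∧ ‖s‖ ≤ 1 - 3 / k := by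
  have hk' : (0 : ℝ) < k := by exact_mod_cast hk
  simp only [grid, Finset.mem_filter, Finset.mem_image, Finset.mem_product, Finset.mem_Icc]
  refine and_congr_left fun hs => ⟨fun ⟨p, _, hp⟩ => ⟨p, hp⟩, fun ⟨p, hp⟩ => ⟨p, ?_, hp⟩⟩
  have hle : ‖s‖ ≤ 1 := hs.trans (by linarith [show (0 : ℝ) ≤ 3 / k by positivity])
  have h1 := (Complex.abs_re_le_norm s).trans hle
  have h2 := (Complex.abs_im_le_norm s).trans hle
  rw [← hp] at h1 h2
  simp only [gridPoint, abs_le, le_div_iff₀ hk', div_le_iff₀ hk'] at h1 h2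
  refine ⟨⟨?_, ?_⟩, ?_, ?_⟩
  · have := h1.1; exact_mod_cast (by linarith : (-(k : ℝ)) ≤ p.1)
  · have := h1.2; exact_mod_cast (by linarith : (p.1 : ℝ) ≤ k)
  · have := h2.1; exact_mod_cast (by linarith : (-(k : ℝ)) ≤ p.2)
  · have := h2.2; exact_mod_cast (by linarith : (p.2 : ℝ) ≤ k)

theorem norm_le_of_mem_grid {k : ℕ} {s : ℂ} (hs : s ∈ grid k) : ‖s‖ ≤ 1 - 3 / k :=
  (Finset.mem_filter.1 hs).2

theorem inv_le_norm_sub_of_mem_grid {k : ℕ} (hk : 0 < k) {s t : ℂ} (hs : s ∈ grid k)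
    (ht : t ∈ grid k) (hst : s ≠ t) : (k : ℝ)⁻¹ ≤ ‖s - t‖ := by
  have hk' : (0 : ℝ) < k := by exact_mod_cast hk
  obtain ⟨⟨p, rfl⟩, -⟩ := (mem_grid hk).1 hs
  obtain ⟨⟨q, rfl⟩, -⟩ := (mem_grid hk).1 ht
  have hpq : p ≠ q := fun h => hst (h ▸ rfl)
  have key : ∀ a b : ℤ, a ≠ b → (k : ℝ)⁻¹ ≤ |(a : ℝ) / k - b / k| := by
    intro a b hab
    rw [← sub_div, abs_div, abs_of_pos hk', inv_eq_one_div]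
    gcongr
    have : 1 ≤ |a - b| := Int.one_le_abs (sub_ne_zero.2 hab)
    exact_mod_cast this
  by_cases h1 : p.1 = q.1
  · have h2 : p.2 ≠ q.2 := fun h2 => hpq (Prod.ext h1 h2)
    exact (key _ _ h2).trans (Complex.abs_im_le_norm (gridPoint k p - gridPoint k q))
  · exact (key _ _ h1).trans (Complex.abs_re_le_norm (gridPoint k p - gridPoint k q))

theorem norm_sub_gridCorner_le {k : ℕ} (hk : 0 < k) (ξ : ℂ) :
    ‖ξ - gridCorner k ξ‖ ≤ 2 * (k : ℝ)⁻¹ := by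
  have hk' : (0 : ℝ) < k := by exact_mod_cast hk
  have key : ∀ x : ℝ, |x - ⌊k * x⌋ / k| ≤ (k : ℝ)⁻¹ := by
    intro x
    have h1 := Int.floor_le (k * x)
    have h2 := Int.lt_floor_add_one (k * x)
    have : x - ⌊k * x⌋ / k = (k * x - ⌊k * x⌋) / k := by field_simp
    rw [this, abs_div, abs_of_pos hk', inv_eq_one_div]
    gcongr
    rw [abs_le]
    constructor <;> linarith
  refine (Complex.norm_le_abs_re_add_abs_im _).trans ?_
  have h1 := key ξ.re
  have h2 := key ξ.im
  simp only [Complex.sub_re, Complex.sub_im, gridCorner, gridPoint]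
  linarith

theorem measurable_gridCorner (k : ℕ) : Measurable (gridCorner k) := by
  have h1 : Measurable fun ξ : ℂ => ((⌊k * ξ.re⌋ : ℝ) / k : ℝ) := by
    refine Measurable.div_const ?_ _
    exact (measurable_from_top (f := fun n : ℤ => (n : ℝ))).comp
      (Int.measurable_floor.comp (Complex.measurable_re.const_mul _))
  have h2 : Measurable fun ξ : ℂ => ((⌊k * ξ.im⌋ : ℝ) / k : ℝ) := by
    refine Measurable.div_const ?_ _
    exact (measurable_from_top (f := fun n : ℤ => (n : ℝ))).comp
      (Int.measurable_floor.comp (Complex.measurable_im.const_mul _))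
  exact Complex.measurableEquivRealProd.symm.measurable.comp (h1.prodMk h2)

theorem volume_gridCorner_preimage {k : ℕ} (hk : 0 < k) (p : ℤ × ℤ) :
    volume (gridCorner k ⁻¹' {gridPoint k p}) = ENNReal.ofReal ((k : ℝ)⁻¹ ^ 2) := by
  have hk' : (0 : ℝ) < k := by exact_mod_cast hk
  have key : ∀ (x : ℝ) (n : ℤ), ⌊k * x⌋ = n ↔ x ∈ Ico ((n : ℝ) / k) ((n + 1) / k) := by
    intro x n
    rw [Int.floor_eq_iff, mem_Ico, div_le_iff₀ hk', lt_div_iff₀ hk', mul_comm x]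
  have : gridCorner k ⁻¹' {gridPoint k p} = Complex.measurableEquivRealProd ⁻¹'
      (Ico ((p.1 : ℝ) / k) ((p.1 + 1) / k) ×ˢ Ico ((p.2 : ℝ) / k) ((p.2 + 1) / k)) := by
    ext ξ
    simp only [mem_preimage, mem_singleton_iff, gridCorner, (gridPoint_injective hk).eq_iff,
      mem_prod, ← key, Complex.measurableEquivRealProd_apply]
    rw [Prod.ext_iff]
  rw [this, Complex.volume_preserving_equiv_real_prod.measure_preimage
    (measurableSet_Ico.prod measurableSet_Ico).nullMeasurableSet, Measure.volume_eq_prod,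
    Measure.prod_prod, Real.volume_Ico, Real.volume_Ico, ← ENNReal.ofReal_mul (by
      rw [← sub_div]; ring_nf; positivity)]
  congr 1
  field_simp
  ring

theorem volume_real_gridCorner_preimage {k : ℕ} (hk : 0 < k) {T : Finset ℂ} (hT : T ⊆ grid k) :
    volume.real (gridCorner k ⁻¹' (T : Set ℂ)) = T.card * (k : ℝ)⁻¹ ^ 2 := by
  have h : gridCorner k ⁻¹' (T : Set ℂ) = ⋃ s ∈ T, gridCorner k ⁻¹' {s} := by
    ext ξ; simp
  have hs : ∀ s ∈ T, volume (gridCorner k ⁻¹' {s}) = ENNReal.ofReal ((k : ℝ)⁻¹ ^ 2) := by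
    intro s hs
    obtain ⟨⟨p, rfl⟩, -⟩ := (mem_grid hk).1 (hT hs)
    exact volume_gridCorner_preimage hk p
  rw [h, measureReal_def, measure_biUnion_finset]
  · rw [Finset.sum_congr rfl hs, Finset.sum_const, nsmul_eq_mul, ENNReal.toReal_mul,
      ENNReal.toReal_ofReal (by positivity), ENNReal.toReal_natCast]
  · intro s _ t _ hst
    exact Disjoint.preimage _ (by simpa using hst)
  · exact fun s _ => measurable_gridCorner k (measurableSet_singleton s)

theorem volume_real_closedBall (u : ℂ) {r : ℝ} (hr : 0 ≤ r) :
    volume.real (Metric.closedBall u r) = Real.pi * r ^ 2 := by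
  rw [measureReal_def, Complex.volume_closedBall, ENNReal.toReal_mul, ENNReal.toReal_pow,
    ENNReal.toReal_ofReal hr]
  simp [mul_comm]

/-- The cells of the points of `T` are disjoint, have area k⁻², and lie in a disc enlarged by the
bound 2/k for the cell diameter. -/
theorem card_filter_grid_le {k : ℕ} (hk : 0 < k) (u : ℂ) {σ : ℝ} (hσ : 0 ≤ σ) {T : Finset ℂ}
    (hT : T ⊆ grid k) (hTu : ∀ s ∈ T, ‖u - s‖ ≤ σ) :
    T.card * (k : ℝ)⁻¹ ^ 2 ≤ Real.pi * (σ + 2 * (k : ℝ)⁻¹) ^ 2 := by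
  rw [← volume_real_gridCorner_preimage hk hT]
  have hsub : gridCorner k ⁻¹' (T : Set ℂ) ⊆ Metric.closedBall u (σ + 2 * (k : ℝ)⁻¹) := by
    intro ξ hξ
    have h1 := hTu _ hξ
    have h2 := norm_sub_gridCorner_le hk ξ
    rw [mem_closedBall_iff_norm]
    calc ‖ξ - u‖ = ‖(ξ - gridCorner k ξ) - (u - gridCorner k ξ)‖ := by congr 1; ring
      _ ≤ _ := norm_sub_le _ _
      _ ≤ _ := by linarith
  refine (measureReal_mono hsub measure_closedBall_lt_top.ne).trans (le_of_eq ?_)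
  exact volume_real_closedBall u (by positivity)

theorem gridCorner_preimage_grid_subset {k : ℕ} (hk : 0 < k) :
    gridCorner k ⁻¹' (grid k : Set ℂ) ⊆ Metric.closedBall 0 1 := by
  intro ξ hξ
  have h1 := norm_le_of_mem_grid (Finset.mem_coe.1 hξ)
  have h2 := norm_sub_gridCorner_le hk ξ
  have h3 : (0 : ℝ) ≤ (k : ℝ)⁻¹ := by positivity
  rw [mem_closedBall_zero_iff]
  have h4 := norm_add_le (ξ - gridCorner k ξ) (gridCorner k ξ)
  rw [sub_add_cancel] at h4
  rw [div_eq_mul_inv] at h1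
  linarith

theorem card_grid_mul_le {k : ℕ} (hk : 0 < k) : (grid k).card * (k : ℝ)⁻¹ ^ 2 ≤ Real.pi := by
  rw [← volume_real_gridCorner_preimage hk subset_rfl]
  refine (measureReal_mono (gridCorner_preimage_grid_subset hk)
    measure_closedBall_lt_top.ne).trans (le_of_eq ?_)
  rw [volume_real_closedBall 0 zero_le_one]
  ring

/-- The cells cover the disc of radius 1 - 5/k: the grid loses 3/k, and passing to a corner costs
2/k. -/
theorem le_card_grid_mul {k : ℕ} (hk : 5 ≤ k) :
    Real.pi * (1 - 10 * (k : ℝ)⁻¹) ≤ (grid k).card * (k : ℝ)⁻¹ ^ 2 := by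
  have hk0 : 0 < k := by omega
  have hk1 : (k : ℝ)⁻¹ ≤ 5⁻¹ := by
    gcongr
    exact_mod_cast hk
  rw [← volume_real_gridCorner_preimage hk0 subset_rfl]
  have hsub : Metric.closedBall 0 (1 - 5 * (k : ℝ)⁻¹) ⊆ gridCorner k ⁻¹' (grid k : Set ℂ) := by
    intro ξ hξ
    rw [mem_closedBall_zero_iff] at hξ
    refine (mem_grid hk0).2 ⟨⟨_, rfl⟩, ?_⟩
    have h2 := norm_sub_gridCorner_le hk0 ξ
    have h4 := norm_sub_le ξ (ξ - gridCorner k ξ)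
    rw [sub_sub_cancel] at h4
    rw [div_eq_mul_inv]
    linarith
  refine le_trans ?_ (measureReal_mono hsub
    (measure_ne_top_of_subset (gridCorner_preimage_grid_subset hk0)
      measure_closedBall_lt_top.ne))
  rw [volume_real_closedBall 0 (by linarith)]
  have := Real.pi_pos
  gcongr
  nlinarith [sq_nonneg (k : ℝ)⁻¹]

/-! ### Riemann sums for the potential of the disc -/

/-- Comparison of the kernel with the potential of a small disc centred at distance
comparable with the scale `ℓ`. -/
theorem norm_tripleKernel_sub_discPotential_le {x y : ℂ} {ℓ r : ℝ} (hr : 0 ≤ r)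
    (hrℓ : 2 * r < ℓ) (hxy : ‖x - y‖ ≤ 2 * ℓ) (hy : ℓ / 2 ≤ ‖y‖) :
    ‖x‖ ≤ 5 * ‖y‖ ∧ (x ≠ 0 → ‖tripleKernel x - discPotential r y‖ ≤ 6 * ‖x‖⁻¹) ∧
      ∀ η, 0 < η → η < ‖x‖ → ‖tripleKernel x - discPotential r y‖ ≤ 40 * ℓ / η ^ 2 := by
  have hℓ : 0 < ℓ := by linarith
  have hy0 : 0 < ‖y‖ := by linarith
  have h5 : ‖x‖ ≤ 5 * ‖y‖ := by
    have := norm_add_le (x - y) y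
    rw [sub_add_cancel] at this
    linarith
  have hinv : ‖x‖ ≠ 0 → ‖y‖⁻¹ ≤ 5 * ‖x‖⁻¹ := by
    intro hx
    have hx0 : 0 < ‖x‖ := lt_of_le_of_ne (norm_nonneg _) (Ne.symm hx)
    rw [inv_eq_one_div, inv_eq_one_div, mul_one_div, div_le_div_iff₀ hy0 hx0]
    linarith
  refine ⟨h5, fun hx => ?_, fun η hη hηx => ?_⟩
  · refine (norm_sub_le _ _).trans ?_
    rw [norm_tripleKernel]
    linarith [norm_discPotential_le hr y, hinv (norm_ne_zero_iff.2 hx)]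
  · have hx0 : 0 < ‖x‖ := hη.trans hηx
    have h1 := norm_tripleKernel_sub_le (norm_pos_iff.1 hx0) (norm_pos_iff.1 hy0)
    have h2 := norm_discPotential_sub_tripleKernel hr (show r < ‖y‖ by linarith)
    have h3 : ‖x - y‖ * (2 * ‖y‖ + ‖x‖) / (‖x‖ ^ 2 * ‖y‖) ≤ 14 * ℓ / η ^ 2 := by
      rw [div_le_div_iff₀ (by positivity) (by positivity)]
      calc ‖x - y‖ * (2 * ‖y‖ + ‖x‖) * η ^ 2 ≤ (2 * ℓ) * (2 * ‖y‖ + 5 * ‖y‖) * ‖x‖ ^ 2 := by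
            gcongr
        _ = _ := by ring
    have h4 : r ^ 2 / ‖y‖ ^ 3 ≤ 25 * ℓ / η ^ 2 := by
      rw [div_le_div_iff₀ (by positivity) (by positivity)]
      calc r ^ 2 * η ^ 2 ≤ (‖y‖ * ℓ) * (5 * ‖y‖) ^ 2 := by
            gcongr
            · rw [sq]
              exact mul_le_mul (by linarith) (by linarith) hr hy0.le
            · exact hηx.le.trans h5
        _ = _ := by ring
    have h5 := norm_sub_le_norm_sub_add_norm_sub (tripleKernel x) (tripleKernel y)
      (discPotential r y)
    rw [norm_sub_rev (tripleKernel y), h2] at h5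
    have h6 : 40 * ℓ / η ^ 2 = 14 * ℓ / η ^ 2 + 25 * ℓ / η ^ 2 + ℓ / η ^ 2 := by ring
    have h7 : 0 ≤ ℓ / η ^ 2 := by positivity
    linarith

theorem sum_grid_eq_setIntegral {k : ℕ} (hk : 0 < k) (g : ℂ → ℂ) :
    (∑ s ∈ grid k, g s) * ((k : ℂ)⁻¹ ^ 2)
      = ∫ ξ in gridCorner k ⁻¹' (grid k : Set ℂ), g (gridCorner k ξ) := by
  have h : gridCorner k ⁻¹' (grid k : Set ℂ) = ⋃ s ∈ grid k, gridCorner k ⁻¹' {s} := by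
    ext ξ; simp
  have hm : ∀ s : ℂ, MeasurableSet (gridCorner k ⁻¹' {s}) := fun s =>
    measurable_gridCorner k (measurableSet_singleton s)
  have hc : ∀ s : ℂ, EqOn (fun ξ => g (gridCorner k ξ)) (fun _ => g s) (gridCorner k ⁻¹' {s}) := by
    intro s ξ hξ
    simp only [mem_preimage, mem_singleton_iff] at hξ
    simp [hξ]
  have hv : ∀ s ∈ grid k, volume (gridCorner k ⁻¹' {s}) = ENNReal.ofReal ((k : ℝ)⁻¹ ^ 2) := by
    intro s hs
    obtain ⟨⟨p, rfl⟩, -⟩ := (mem_grid hk).1 hs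
    exact volume_gridCorner_preimage hk p
  rw [h, integral_biUnion_finset _ (fun s _ => hm s)]
  · rw [Finset.sum_mul]
    refine Finset.sum_congr rfl fun s hs => ?_
    rw [setIntegral_congr_fun (hm s) (hc s), setIntegral_const, measureReal_def, hv s hs,
      ENNReal.toReal_ofReal (by positivity), Complex.real_smul]
    push_cast
    ring
  · intro s _ t _ hst
    exact Disjoint.preimage _ (by simpa using hst)
  · intro s hs
    refine (integrableOn_congr_fun (hc s) (hm s)).2 (integrableOn_const ?_)
    rw [hv s hs]
    exact ENNReal.ofReal_ne_top

theorem card_grid_bounds {k : ℕ} (hk : 20 ≤ k) :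
    (k : ℝ) ^ 2 ≤ (grid k).card ∧ ((grid k).card : ℝ) ≤ 4 * (k : ℝ) ^ 2 := by
  have hk0 : (0 : ℝ) < k := by exact_mod_cast (by omega : 0 < k)
  have hk1 : (k : ℝ)⁻¹ ≤ 20⁻¹ := by
    gcongr
    exact_mod_cast hk
  have h1 := card_grid_mul_le (k := k) (by omega)
  have h2 := le_card_grid_mul (k := k) (by omega)
  have hpi := Real.pi_gt_three
  have hpi' := Real.pi_lt_four
  have h3 : (1 : ℝ) ≤ (grid k).card * (k : ℝ)⁻¹ ^ 2 := by nlinarith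
  have h4 : (grid k).card * (k : ℝ)⁻¹ ^ 2 ≤ (4 : ℝ) := by linarith
  rw [inv_pow, ← div_eq_mul_inv] at h3 h4
  rw [le_div_iff₀ (by positivity)] at h3
  rw [div_le_iff₀ (by positivity)] at h4
  exact ⟨by linarith, h4⟩

open Classical in
/-- The lattice approximation of the potential of the disc, with the lattice point near `u`
removed. -/
noncomputable def gridPotential (k : ℕ) (u : ℂ) : ℂ :=
  ((grid k).card : ℂ)⁻¹ * ∑ s ∈ grid k,
    if (k : ℝ)⁻¹ / 2 ≤ ‖u - s‖ then discPotential ((grid k).card : ℝ)⁻¹ (u - s) else 0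

/-- The area integral of K over the unit disc is compared cell by cell with the lattice sum. Within
η of u the integrable singularity costs O(η); farther away the kernel is bounded and regular, and
the error is O(1/k) for fixed η. What remains is the area not covered by cells. -/
theorem norm_discPotential_sub_gridPotential_le {k : ℕ} (hk : 20 ≤ k) (u : ℂ) {η : ℝ}
    (hkη : 3 * (k : ℝ)⁻¹ ≤ η) :
    ‖discPotential 1 u - gridPotential k u‖
      ≤ 14 * η + (10 / η + 40 / η ^ 2 + 300) * (k : ℝ)⁻¹ := by
  classical
  obtain ⟨hN1, hN4⟩ := card_grid_bounds hk
  have hk0 : 0 < k := by omega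
  have hkR : (20 : ℝ) ≤ k := by exact_mod_cast hk
  have hk1 : (k : ℝ)⁻¹ ≤ 20⁻¹ := by gcongr
  have hV1 := card_grid_mul_le hk0
  have hV2 := le_card_grid_mul (k := k) (by omega)
  set ℓ : ℝ := (k : ℝ)⁻¹ with hℓ
  have hℓ0 : 0 < ℓ := by positivity
  have hη : 0 < η := by linarith
  set N : ℝ := ((grid k).card : ℝ) with hN
  have hN0 : 0 < N := by nlinarith
  set r : ℝ := N⁻¹ with hr
  have hr0 : 0 ≤ r := by positivity
  have hrℓ : 2 * r < ℓ := by
    rw [hr, hℓ, ← div_eq_mul_inv, inv_eq_one_div, div_lt_div_iff₀ hN0 (by positivity)]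
    nlinarith
  set g : ℂ → ℂ := fun s => if ℓ / 2 ≤ ‖u - s‖ then discPotential r (u - s) else 0 with hg
  set U := gridCorner k ⁻¹' (grid k : Set ℂ) with hU
  set D := Metric.closedBall (0 : ℂ) 1 with hD
  have hUD : U ⊆ D := gridCorner_preimage_grid_subset hk0
  have hUm : MeasurableSet U := measurable_gridCorner k (grid k).measurableSet
  have hDm : MeasurableSet D := Metric.isClosed_closedBall.measurableSet
  have hDfin : volume D ≠ ⊤ := measure_closedBall_lt_top.ne
  have hUfin : volume U ≠ ⊤ := measure_ne_top_of_subset hUD hDfin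
  have hDv : volume.real D = Real.pi := by rw [volume_real_closedBall 0 zero_le_one]; ring
  have hUv : volume.real U = N * ℓ ^ 2 := volume_real_gridCorner_preimage hk0 subset_rfl
  have hdv : volume.real (D \ U) = Real.pi - N * ℓ ^ 2 := by
    rw [measureReal_sdiff hUD hUm hDfin, hDv, hUv]
  have hKD := integrableOn_tripleKernel_sub u (s := D) Metric.isBounded_closedBall
  have hxy : ∀ ξ, ‖(u - ξ) - (u - gridCorner k ξ)‖ ≤ 2 * ℓ := by
    intro ξ
    rw [sub_sub_sub_cancel_left, norm_sub_rev]
    exact norm_sub_gridCorner_le hk0 ξ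
  -- Either the corner is so close to u that its term is removed, and then ξ is within 3ℓ ≤ η of u;
  -- or the corner is at distance at least ℓ/2, as the kernel comparison requires.
  have hgc : ∀ ξ, ‖u - ξ‖ ≤ 3 * ℓ ∧ g (gridCorner k ξ) = 0 ∨
      ℓ / 2 ≤ ‖u - gridCorner k ξ‖ ∧ g (gridCorner k ξ) = discPotential r (u - gridCorner k ξ) := by
    intro ξ
    by_cases h : ℓ / 2 ≤ ‖u - gridCorner k ξ‖
    · exact Or.inr ⟨h, if_pos h⟩
    · refine Or.inl ⟨?_, if_neg h⟩
      have := norm_add_le ((u - ξ) - (u - gridCorner k ξ)) (u - gridCorner k ξ)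
      rw [sub_add_cancel] at this
      linarith [hxy ξ]
  have hgmeas : Measurable fun ξ => g (gridCorner k ξ) := by
    have hΦ : Measurable (discPotential r) := by
      unfold discPotential
      refine Measurable.ite (measurableSet_le measurable_norm measurable_const)
        measurable_const ?_
      fun_prop
    have hg' : Measurable g := by
      refine Measurable.ite (measurableSet_le measurable_const (by fun_prop))
        (hΦ.comp (by fun_prop)) measurable_const
    exact hg'.comp (measurable_gridCorner k)
  have hgint : IntegrableOn (fun ξ => g (gridCorner k ξ)) U := by
    have : IsFiniteMeasure (volume.restrict U) := ⟨by simpa using hUfin.lt_top⟩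
    refine Integrable.of_bound hgmeas.aestronglyMeasurable (2 * ℓ⁻¹)
      (Filter.Eventually.of_forall fun ξ => ?_)
    rcases hgc ξ with ⟨-, h⟩ | ⟨h1, h⟩
    · rw [h, norm_zero]; positivity
    · rw [h]
      refine (norm_discPotential_le hr0 _).trans ?_
      rw [inv_eq_one_div, ← div_eq_mul_inv]
      exact (one_div_le_one_div_of_le (by positivity) h1).trans (le_of_eq (by field_simp))
  have hE1 : ‖∫ ξ in D \ U, tripleKernel (u - ξ)‖
      ≤ 2 * Real.pi * η * 1 + η⁻¹ * volume.real (D \ U) := by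
    refine norm_setIntegral_le_near_far (hDm.diff hUm) (measure_ne_top_of_subset sdiff_subset hDfin)
      u hη.le zero_le_one (by positivity) (fun ξ _ _ _ => ?_) (fun ξ _ h => ?_)
    · rw [norm_tripleKernel, one_mul]
    · rw [norm_tripleKernel]
      gcongr
  have hE2 : ‖∫ ξ in U, (tripleKernel (u - ξ) - g (gridCorner k ξ))‖
      ≤ 2 * Real.pi * η * 6 + 40 * ℓ / η ^ 2 * volume.real U := by
    refine norm_setIntegral_le_near_far hUm hUfin u hη.le (by norm_num) (by positivity)
      (fun ξ _ hξ h => ?_) (fun ξ _ h => ?_)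
    · rcases hgc ξ with ⟨-, h⟩ | ⟨h1, h⟩
      · rw [h, sub_zero, norm_tripleKernel]
        linarith [inv_nonneg.2 (norm_nonneg (u - ξ))]
      · rw [h]
        exact (norm_tripleKernel_sub_discPotential_le hr0 hrℓ (hxy ξ) h1).2.1 hξ
    · rcases hgc ξ with ⟨h2, -⟩ | ⟨h1, h2⟩
      · linarith
      · rw [h2]
        exact (norm_tripleKernel_sub_discPotential_le hr0 hrℓ (hxy ξ) h1).2.2 η hη h
  -- A crude bound suffices here: this integral only enters multiplied by the area defect.
  have hE3 : ‖∫ ξ in U, g (gridCorner k ξ)‖ ≤ 2 * Real.pi * 1 * 5 + 5 * volume.real U := by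
    have key : ∀ ξ, u - ξ ≠ 0 → ‖g (gridCorner k ξ)‖ ≤ 5 * ‖u - ξ‖⁻¹ := by
      intro ξ hξ
      rcases hgc ξ with ⟨-, h⟩ | ⟨h1, h⟩
      · rw [h, norm_zero]; positivity
      · rw [h]
        refine (norm_discPotential_le hr0 _).trans ?_
        have h2 := (norm_tripleKernel_sub_discPotential_le hr0 hrℓ (hxy ξ) h1).1
        have h3 : 0 < ‖u - ξ‖ := norm_pos_iff.2 hξ
        rw [inv_eq_one_div, inv_eq_one_div, mul_one_div, div_le_div_iff₀ (by linarith) h3]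
        linarith
    refine norm_setIntegral_le_near_far hUm hUfin u zero_le_one (by norm_num) (by norm_num)
      (fun ξ _ hξ _ => key ξ hξ) (fun ξ _ h => ?_)
    refine (key ξ (norm_pos_iff.1 (zero_lt_one.trans h))).trans ?_
    linarith [inv_le_one_of_one_le₀ h.le]
  have hpi := Real.pi_pos
  have hpi3 := Real.pi_gt_three
  have hpiC : (Real.pi : ℂ) ≠ 0 := by exact_mod_cast hpi.ne'
  set I1 := ∫ ξ in D \ U, tripleKernel (u - ξ)
  set I2 := ∫ ξ in U, (tripleKernel (u - ξ) - g (gridCorner k ξ)) with hI2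
  set I3 := ∫ ξ in U, g (gridCorner k ξ) with hI3
  have hΦ : Real.pi * discPotential 1 u = I1 + I2 + I3 := by
    have h1 := setIntegral_union (disjoint_sdiff_left : Disjoint (D \ U) U) hUm
      (hKD.mono_set sdiff_subset) (hKD.mono_set hUD)
    rw [sdiff_union_of_subset hUD] at h1
    rw [hI2, integral_sub (hKD.mono_set hUD) hgint, ← hI3, ← setIntegral_tripleKernel_unitDisc,
      ← hD, h1]
    ring
  have hG : (N : ℂ) * ((ℓ : ℂ) ^ 2) * gridPotential k u = I3 := by
    rw [hI3, ← sum_grid_eq_setIntegral hk0, gridPotential, hN, hℓ]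
    have : ((grid k).card : ℂ) ≠ 0 := by
      rw [hN] at hN0
      exact_mod_cast hN0.ne'
    push_cast
    rw [mul_comm _ ((k : ℂ)⁻¹ ^ 2), mul_assoc, mul_inv_cancel_left₀ this, mul_comm]
  set a : ℝ := N * ℓ ^ 2 with ha
  have ha2 : Real.pi / 2 ≤ a := by nlinarith
  have ha0 : 0 < a := by linarith
  have haC : (a : ℂ) ≠ 0 := by exact_mod_cast ha0.ne'
  -- The disc integral is normalized by π, the lattice sum by the total cell area `a`; the last term
  -- corrects for this.
  have hsplit : discPotential 1 u - gridPotential k u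
      = ((Real.pi⁻¹ : ℝ) : ℂ) * (I1 + I2) - (((Real.pi - a) / (Real.pi * a) : ℝ) : ℂ) * I3 := by
    have h1 : discPotential 1 u = (I1 + I2 + I3) / Real.pi := by
      rw [← hΦ]; field_simp
    have h2 : gridPotential k u = I3 / a := by
      rw [eq_div_iff haC, ← hG, ha]
      push_cast
      ring
    rw [h1, h2]
    push_cast
    field_simp
    ring
  -- Uses π - a ≤ 10πℓ and a ≥ π/2.
  have hb1 : (Real.pi - a) / (Real.pi * a) ≤ 20 * ℓ / Real.pi := by
    rw [div_le_div_iff₀ (by positivity) hpi]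
    nlinarith
  have hb0 : 0 ≤ (Real.pi - a) / (Real.pi * a) := div_nonneg (by linarith) (by positivity)
  have hI1' : ‖I1‖ ≤ Real.pi * (2 * η + 10 * ℓ / η) := by
    refine hE1.trans ?_
    rw [hdv]
    have : η⁻¹ * (Real.pi - a) ≤ η⁻¹ * (Real.pi * (10 * ℓ)) := by gcongr; linarith
    refine (add_le_add_right this _).trans (le_of_eq ?_)
    field_simp
  have hI2' : ‖I2‖ ≤ Real.pi * (12 * η + 40 * ℓ / η ^ 2) := by
    refine hE2.trans ?_
    rw [hUv]
    have : 40 * ℓ / η ^ 2 * a ≤ 40 * ℓ / η ^ 2 * Real.pi := by gcongr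
    linarith
  have hI3' : ‖I3‖ ≤ Real.pi * 15 := by
    refine hE3.trans ?_
    rw [hUv]
    linarith
  rw [hsplit]
  calc _ ≤ Real.pi⁻¹ * (‖I1‖ + ‖I2‖) + (Real.pi - a) / (Real.pi * a) * ‖I3‖ := by
        refine (norm_sub_le _ _).trans ?_
        rw [norm_mul, norm_mul, Complex.norm_real, Complex.norm_real, Real.norm_of_nonneg hb0,
          Real.norm_of_nonneg (by positivity)]
        gcongr
        exact norm_add_le _ _
    _ ≤ Real.pi⁻¹ * (Real.pi * (2 * η + 10 * ℓ / η) + Real.pi * (12 * η + 40 * ℓ / η ^ 2))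
        + 20 * ℓ / Real.pi * (Real.pi * 15) := by gcongr
    _ = 14 * η + (10 / η + 40 / η ^ 2 + 300) * ℓ := by field_simp; ring

open Filter in
/-- The lattice approximation of the potential of the unit disc is uniformly good. -/
theorem eventually_norm_discPotential_sub_gridPotential_le {ε : ℝ} (hε : 0 < ε) :
    ∀ᶠ k : ℕ in atTop, ∀ u, ‖discPotential 1 u - gridPotential k u‖ ≤ ε := by
  set η := min 1 (ε / 28) with hη
  have hη0 : 0 < η := by positivity
  have hηε : 14 * η ≤ ε / 2 := by linarith [min_le_right 1 (ε / 28)]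
  have h0 : Tendsto (fun k : ℕ => (k : ℝ)⁻¹) atTop (nhds 0) := tendsto_inv_atTop_nhds_zero_nat
  have h1 := h0.const_mul 3
  have h2 := h0.const_mul (10 / η + 40 / η ^ 2 + 300)
  rw [mul_zero] at h1 h2
  filter_upwards [eventually_ge_atTop 20, h1.eventually_le_const hη0,
    h2.eventually_le_const (half_pos hε)] with k hk hk1 hk2 u
  linarith [norm_discPotential_sub_gridPotential_le hk u hk1]

/-! ### The Cantor construction -/

/-- The number of discs at level `n` of the Cantor construction with mesh sizes `1 / k i`. -/
noncomputable def levelCard (k : ℕ → ℕ) (n : ℕ) : ℕ := ∏ i ∈ Finset.range n, (grid (k i)).card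

/-- The common radius of the discs at level `n`. -/
noncomputable def levelRadius (k : ℕ → ℕ) (n : ℕ) : ℝ := (levelCard k n : ℝ)⁻¹

open Classical in
/-- The centres of the discs at level `n`. -/
noncomputable def levelCenters (k : ℕ → ℕ) : ℕ → Finset ℂ
  | 0 => {0}
  | n + 1 => (levelCenters k n ×ˢ grid (k n)).image fun p => p.1 + levelRadius k n * p.2

/-- The mesh sizes decrease so fast that each step of the construction changes the potential
by a summable amount away from the new discs. -/
structure IsAdmissible (k : ℕ → ℕ) : Prop where
  le : ∀ n, 20 + 2 ^ n ≤ k n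
  norm_sub_le : ∀ n u, ‖discPotential 1 u - gridPotential (k n) u‖ ≤ (1 / 2) ^ n * levelRadius k n

/-- The required accuracy at level n involves only the radius at level n, hence only earlier meshes,
so the meshes can be chosen recursively. -/
theorem exists_isAdmissible : ∃ k, IsAdmissible k := by
  -- The guard `0 < M` makes the tolerance positive; for M = 0 the convention 0⁻¹ = 0 would demand
  -- exact equality.
  have h : ∀ n M : ℕ, ∃ m : ℕ, 20 + 2 ^ n ≤ m ∧ (0 < M →
      ∀ u, ‖discPotential 1 u - gridPotential m u‖ ≤ (1 / 2) ^ n * (M : ℝ)⁻¹) := by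
    intro n M
    rcases Nat.eq_zero_or_pos M with rfl | hM
    · exact ⟨_, le_rfl, fun h => absurd h (lt_irrefl 0)⟩
    · have hM' : (0 : ℝ) < M := by exact_mod_cast hM
      obtain ⟨m, h1, h2⟩ := ((Filter.eventually_ge_atTop (20 + 2 ^ n)).and
        (eventually_norm_discPotential_sub_gridPotential_le
          (show (0 : ℝ) < (1 / 2) ^ n * (M : ℝ)⁻¹ by positivity))).exists
      exact ⟨m, h1, fun _ => h2⟩
  choose f hf1 hf2 using h
  -- `M n` runs the recursion on the number of discs; `hM` then identifies it with `levelCard`.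
  let M : ℕ → ℕ := fun n => Nat.rec 1 (fun n m => m * (grid (f n m)).card) n
  have hM : ∀ n, levelCard (fun n => f n (M n)) n = M n := by
    intro n
    induction n with
    | zero => simp [levelCard, M]
    | succ n ih =>
      rw [levelCard, Finset.prod_range_succ, ← levelCard, ih]
  have hpos : ∀ n, 0 < M n := by
    intro n
    induction n with
    | zero => simp [M]
    | succ n ih =>
      refine Nat.mul_pos ih ?_
      have h1 := (Nat.le_add_right _ _).trans (hf1 n (M n))
      have h2 := (card_grid_bounds h1).1
      have h3 : (20 : ℝ) ≤ f n (M n) := by exact_mod_cast h1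
      exact Nat.cast_pos.1 (lt_of_lt_of_le (by positivity) h2)
  refine ⟨fun n => f n (M n), fun n => hf1 n _, fun n u => ?_⟩
  rw [levelRadius, hM]
  exact hf2 n (M n) (hpos n) u

theorem levelCard_succ (k : ℕ → ℕ) (n : ℕ) :
    levelCard k (n + 1) = levelCard k n * (grid (k n)).card := Finset.prod_range_succ _ _

theorem levelRadius_zero (k : ℕ → ℕ) : levelRadius k 0 = 1 := by simp [levelRadius, levelCard]

theorem levelRadius_succ (k : ℕ → ℕ) (n : ℕ) :
    levelRadius k (n + 1) = levelRadius k n * ((grid (k n)).card : ℝ)⁻¹ := by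
  rw [levelRadius, levelRadius, levelCard_succ, Nat.cast_mul, mul_inv]

theorem mem_levelCenters_succ {k : ℕ → ℕ} {n : ℕ} {x : ℂ} :
    x ∈ levelCenters k (n + 1) ↔
      ∃ c ∈ levelCenters k n, ∃ s ∈ grid (k n), c + levelRadius k n * s = x := by
  simp only [levelCenters, Finset.mem_image, Finset.mem_product, Prod.exists]
  grind

namespace IsAdmissible

variable {k : ℕ → ℕ}

theorem twenty_le (hk : IsAdmissible k) (n : ℕ) : 20 ≤ k n :=
  (Nat.le_add_right _ _).trans (hk.le n)

theorem pos (hk : IsAdmissible k) (n : ℕ) : 0 < k n := by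
  have := hk.twenty_le n
  omega

theorem sq_le_card (hk : IsAdmissible k) (n : ℕ) : (k n : ℝ) ^ 2 ≤ (grid (k n)).card :=
  (card_grid_bounds (hk.twenty_le n)).1

theorem twenty_le_cast (hk : IsAdmissible k) (n : ℕ) : (20 : ℝ) ≤ k n := by
  exact_mod_cast hk.twenty_le n

theorem card_pos (hk : IsAdmissible k) (n : ℕ) : (0 : ℝ) < (grid (k n)).card := by
  have := hk.twenty_le_cast n
  exact lt_of_lt_of_le (by positivity) (hk.sq_le_card n)

theorem levelCard_pos (hk : IsAdmissible k) (n : ℕ) : 0 < levelCard k n :=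
  Finset.prod_pos fun i _ => Nat.cast_pos.1 (hk.card_pos i)

theorem levelRadius_pos (hk : IsAdmissible k) (n : ℕ) : 0 < levelRadius k n :=
  inv_pos.2 (Nat.cast_pos.2 (hk.levelCard_pos n))

/-- The mesh at level `n` is much larger than the radius at level `n + 1`. -/
theorem mul_levelRadius_succ_le (hk : IsAdmissible k) (n : ℕ) :
    k n * levelRadius k (n + 1) ≤ (k n : ℝ)⁻¹ * levelRadius k n := by
  have h1 := hk.sq_le_card n
  have h2 := hk.twenty_le_cast n
  have h3 := hk.card_pos n
  have h4 := hk.levelRadius_pos n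
  have h2' : (0 : ℝ) < k n := by linarith
  rw [levelRadius_succ, mul_comm (levelRadius k n), ← mul_assoc]
  gcongr
  rw [← div_eq_mul_inv, inv_eq_one_div, div_le_div_iff₀ h3 h2']
  nlinarith

theorem inv_le (hk : IsAdmissible k) (n : ℕ) : (k n : ℝ)⁻¹ ≤ 20⁻¹ := by
  have := hk.twenty_le_cast n
  gcongr

theorem twenty_mul_levelRadius_succ_le (hk : IsAdmissible k) (n : ℕ) :
    20 * levelRadius k (n + 1) ≤ (k n : ℝ)⁻¹ * levelRadius k n :=
  (mul_le_mul_of_nonneg_right (hk.twenty_le_cast n) (hk.levelRadius_pos _).le).trans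
    (hk.mul_levelRadius_succ_le n)

/-- One factor 2⁻ⁿ matches the width of the enlargement in `NearLevel`, the other is the gain in the
potential of a new disc seen from outside it. -/
theorem levelRadius_succ_le (hk : IsAdmissible k) (n : ℕ) :
    levelRadius k (n + 1) ≤ (1 / 2) ^ n * ((1 / 2) ^ n * levelRadius k n) := by
  have h1 := hk.sq_le_card n
  have h2 : (2 : ℝ) ^ n ≤ k n := by
    have := hk.le n
    exact_mod_cast (by omega : 2 ^ n ≤ k n)
  have h3 : (2 : ℝ) ^ n * 2 ^ n ≤ (grid (k n)).card := by
    have h0 : (0 : ℝ) < 2 ^ n := by positivity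
    nlinarith
  have h4 := hk.levelRadius_pos n
  rw [levelRadius_succ, mul_comm (levelRadius k n), ← mul_assoc]
  gcongr
  rw [one_div, inv_pow, ← mul_inv]
  gcongr

theorem levelRadius_succ_le_half (hk : IsAdmissible k) (n : ℕ) :
    levelRadius k (n + 1) ≤ 1 / 2 * levelRadius k n := by
  have h1 := hk.twenty_mul_levelRadius_succ_le n
  have h2 := hk.inv_le n
  have h3 := hk.levelRadius_pos n
  nlinarith

theorem levelRadius_le (hk : IsAdmissible k) (n : ℕ) : levelRadius k n ≤ (1 / 2) ^ n := by
  induction n with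
  | zero => simp [levelRadius_zero]
  | succ n ih =>
    have := hk.levelRadius_succ_le_half n
    rw [pow_succ]
    linarith

/-- The margin 3/k in `grid` keeps a child disc, even with doubled radius, inside its parent. -/
theorem norm_grid_mul_le (hk : IsAdmissible k) {n : ℕ} {s : ℂ} (hs : s ∈ grid (k n)) :
    ‖levelRadius k n * s‖ + 2 * levelRadius k (n + 1) ≤ levelRadius k n := by
  have h1 := norm_le_of_mem_grid hs
  have h2 := hk.twenty_mul_levelRadius_succ_le n
  have h3 := hk.levelRadius_pos n
  have h4 : (0 : ℝ) < (k n : ℝ)⁻¹ := inv_pos.2 (Nat.cast_pos.2 (hk.pos n))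
  rw [norm_mul, Complex.norm_real, Real.norm_of_nonneg h3.le]
  rw [div_eq_mul_inv] at h1
  nlinarith [hk.levelRadius_pos (n + 1), mul_pos h3 h4]

theorem four_mul_le_of_le (hk : IsAdmissible k) {n : ℕ} {x y : ℂ}
    (h : (k n : ℝ)⁻¹ * levelRadius k n ≤ ‖x - y‖) : 4 * levelRadius k (n + 1) ≤ ‖x - y‖ := by
  linarith [hk.twenty_mul_levelRadius_succ_le n, hk.levelRadius_pos (n + 1)]

/-- Children of one parent are separated by the lattice; children of different parents inherit the
separation of the parents, since each stays within the radius of its own parent. -/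
theorem separated_add (hk : IsAdmissible k) {n : ℕ}
    (hsep : ∀ c ∈ levelCenters k n, ∀ c' ∈ levelCenters k n, c ≠ c' →
      4 * levelRadius k n ≤ ‖c - c'‖)
    {c c' s s' : ℂ} (hc : c ∈ levelCenters k n) (hc' : c' ∈ levelCenters k n)
    (hs : s ∈ grid (k n)) (hs' : s' ∈ grid (k n)) (hne : (c, s) ≠ (c', s')) :
    (k n : ℝ)⁻¹ * levelRadius k n ≤ ‖c + levelRadius k n * s - (c' + levelRadius k n * s')‖ := by
  have h3 := hk.levelRadius_pos n
  by_cases hcc : c = c'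
  · subst hcc
    have hss : s ≠ s' := fun h => hne (by rw [h])
    rw [add_sub_add_left_eq_sub, ← mul_sub, norm_mul, Complex.norm_real,
      Real.norm_of_nonneg h3.le, mul_comm]
    gcongr
    exact inv_le_norm_sub_of_mem_grid (hk.pos n) hs hs' hss
  · have h1 := hsep c hc c' hc' hcc
    have h4 := hk.norm_grid_mul_le hs
    have h5 := hk.norm_grid_mul_le hs'
    have h6 := hk.levelRadius_pos (n + 1)
    have h7 : ‖c - c'‖ ≤ ‖c + levelRadius k n * s - (c' + levelRadius k n * s')‖
        + (‖levelRadius k n * s‖ + ‖levelRadius k n * s'‖) := by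
      calc ‖c - c'‖ = ‖(c + levelRadius k n * s - (c' + levelRadius k n * s'))
            - (levelRadius k n * s - levelRadius k n * s')‖ := by congr 1; ring
        _ ≤ _ := (_root_.norm_sub_le _ _).trans (by gcongr; exact _root_.norm_sub_le _ _)
    have h8 := hk.inv_le n
    nlinarith

theorem separated (hk : IsAdmissible k) (n : ℕ) : ∀ c ∈ levelCenters k n,
    ∀ c' ∈ levelCenters k n, c ≠ c' → 4 * levelRadius k n ≤ ‖c - c'‖ := by
  induction n with
  | zero =>
    intro c hc c' hc' h
    simp only [levelCenters, Finset.mem_singleton] at hc hc'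
    exact absurd (hc.trans hc'.symm) h
  | succ n ih =>
    intro x hx y hy hxy
    obtain ⟨c, hc, s, hs, rfl⟩ := mem_levelCenters_succ.1 hx
    obtain ⟨c', hc', s', hs', rfl⟩ := mem_levelCenters_succ.1 hy
    refine hk.four_mul_le_of_le (hk.separated_add ih hc hc' hs hs' fun h => hxy ?_)
    obtain ⟨rfl, rfl⟩ := Prod.ext_iff.1 h
    rfl

theorem separated_succ (hk : IsAdmissible k) (n : ℕ) {x y : ℂ} (hx : x ∈ levelCenters k (n + 1))
    (hy : y ∈ levelCenters k (n + 1)) (hxy : x ≠ y) :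
    (k n : ℝ)⁻¹ * levelRadius k n ≤ ‖x - y‖ := by
  obtain ⟨c, hc, s, hs, rfl⟩ := mem_levelCenters_succ.1 hx
  obtain ⟨c', hc', s', hs', rfl⟩ := mem_levelCenters_succ.1 hy
  refine hk.separated_add (hk.separated n) hc hc' hs hs' fun h => hxy ?_
  obtain ⟨rfl, rfl⟩ := Prod.ext_iff.1 h
  rfl

theorem injOn_add (hk : IsAdmissible k) (n : ℕ) :
    InjOn (fun p : ℂ × ℂ => p.1 + levelRadius k n * p.2)
      (levelCenters k n ×ˢ grid (k n) : Finset (ℂ × ℂ)) := by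
  rintro ⟨c, s⟩ h ⟨c', s'⟩ h' heq
  simp only [Finset.coe_product, mem_prod, Finset.mem_coe] at h h' heq
  by_contra hne
  have h1 := hk.separated_add (hk.separated n) h.1 h'.1 h.2 h'.2 hne
  rw [heq, sub_self, norm_zero] at h1
  have h2 := mul_pos (inv_pos.2 (Nat.cast_pos.2 (hk.pos n) : (0 : ℝ) < k n)) (hk.levelRadius_pos n)
  linarith

theorem card_levelCenters (hk : IsAdmissible k) (n : ℕ) :
    (levelCenters k n).card = levelCard k n := by
  induction n with
  | zero => simp [levelCenters, levelCard]
  | succ n ih =>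
    rw [levelCenters, Finset.card_image_of_injOn (hk.injOn_add n), Finset.card_product, ih,
      levelCard_succ]

theorem sum_levelCenters_succ (hk : IsAdmissible k) (n : ℕ) (f : ℂ → ℂ) :
    ∑ x ∈ levelCenters k (n + 1), f x
      = ∑ c ∈ levelCenters k n, ∑ s ∈ grid (k n), f (c + levelRadius k n * s) := by
  rw [levelCenters, Finset.sum_image (hk.injOn_add n), Finset.sum_product]

end IsAdmissible

/-! ### Uniform bound for the level potentials -/

/-- The potential of the uniform distribution on the discs at level `n`. -/
noncomputable def levelPotential (k : ℕ → ℕ) (n : ℕ) (w : ℂ) : ℂ :=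
  levelRadius k n * ∑ c ∈ levelCenters k n, discPotential (levelRadius k n) (w - c)

open Classical in
/-- The contribution to the potential of the disc at level `n + 1` nearest to `w`. -/
noncomputable def nearPotential (k : ℕ → ℕ) (n : ℕ) (w : ℂ) : ℂ :=
  ∑ c ∈ levelCenters k (n + 1), if ‖w - c‖ < (k n : ℝ)⁻¹ * levelRadius k n / 2 then
    discPotential 1 ((w - c) / levelRadius k (n + 1)) else 0

theorem mul_discPotential {a : ℝ} (ha : 0 < a) (z : ℂ) :
    a * discPotential a z = discPotential 1 (z / a) := by
  have ha' : (a : ℂ) ≠ 0 := by exact_mod_cast ha.ne'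
  have h := discPotential_mul ha 1 (z / a)
  rw [mul_one, mul_div_cancel₀ _ ha'] at h
  rw [h, mul_inv_cancel_left₀ ha']

namespace IsAdmissible

variable {k : ℕ → ℕ}

theorem levelPotential_eq_sum (hk : IsAdmissible k) (n : ℕ) (w : ℂ) :
    levelPotential k n w
      = ∑ c ∈ levelCenters k n, discPotential 1 ((w - c) / levelRadius k n) := by
  rw [levelPotential, Finset.mul_sum]
  exact Finset.sum_congr rfl fun c _ => mul_discPotential (hk.levelRadius_pos n) _

/-- After rescaling each parent to the unit disc, its children contribute exactly the lattice sum,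
except for a child so close to w that `gridPotential` omits it; `nearPotential` restores it. -/
theorem levelPotential_succ_sub (hk : IsAdmissible k) (n : ℕ) (w : ℂ) :
    levelPotential k (n + 1) w - levelPotential k n w
      = (∑ c ∈ levelCenters k n, (gridPotential (k n) ((w - c) / levelRadius k n)
          - discPotential 1 ((w - c) / levelRadius k n))) + nearPotential k n w := by
  classical
  have hR := hk.levelRadius_pos n
  have hRC : (levelRadius k n : ℂ) ≠ 0 := by exact_mod_cast hR.ne'
  have hN := hk.card_pos n
  have hNC : ((grid (k n)).card : ℂ) ≠ 0 := by exact_mod_cast hN.ne'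
  rw [hk.levelPotential_eq_sum, hk.levelPotential_eq_sum, nearPotential,
    hk.sum_levelCenters_succ, hk.sum_levelCenters_succ, Finset.sum_sub_distrib, sub_add_eq_add_sub,
    ← Finset.sum_add_distrib]
  congr 1
  refine Finset.sum_congr rfl fun c _ => ?_
  rw [gridPotential, Finset.mul_sum, ← Finset.sum_add_distrib]
  refine Finset.sum_congr rfl fun s _ => ?_
  have h1 : (w - c) / levelRadius k n - s = (w - (c + levelRadius k n * s)) / levelRadius k n := by
    field_simp
    ring
  have h2 : ((grid (k n)).card : ℂ)⁻¹ * discPotential ((grid (k n)).card : ℝ)⁻¹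
      ((w - c) / levelRadius k n - s)
      = discPotential 1 ((w - (c + levelRadius k n * s)) / levelRadius k (n + 1)) := by
    have := mul_discPotential (inv_pos.2 hN) ((w - c) / levelRadius k n - s)
    push_cast at this
    rw [this, h1, levelRadius_succ]
    push_cast
    rw [div_div]
  have h3 : ‖w - (c + levelRadius k n * s)‖ < (k n : ℝ)⁻¹ * levelRadius k n / 2
      ↔ ¬ (k n : ℝ)⁻¹ / 2 ≤ ‖(w - c) / levelRadius k n - s‖ := by
    rw [not_le, h1, norm_div, Complex.norm_real, Real.norm_of_nonneg hR.le, div_lt_iff₀ hR]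
    ring_nf
  rw [← h2]
  by_cases h : (k n : ℝ)⁻¹ / 2 ≤ ‖(w - c) / levelRadius k n - s‖
  · rw [if_pos h, if_neg (by rwa [h3, not_not]), add_zero]
  · rw [if_neg h, if_pos (by rwa [h3]), mul_zero, zero_add]

/-- The cutoff is half the separation of the centres, so at most one term is nonzero. -/
theorem norm_nearPotential_le (hk : IsAdmissible k) {n : ℕ} {w : ℂ} {B : ℝ} (hB : 0 ≤ B)
    (h : ∀ c ∈ levelCenters k (n + 1), ‖w - c‖ < (k n : ℝ)⁻¹ * levelRadius k n / 2 →
      ‖discPotential 1 ((w - c) / levelRadius k (n + 1))‖ ≤ B) : ‖nearPotential k n w‖ ≤ B := by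
  classical
  by_cases hex : ∃ c ∈ levelCenters k (n + 1), ‖w - c‖ < (k n : ℝ)⁻¹ * levelRadius k n / 2
  · obtain ⟨c, hc, hwc⟩ := hex
    rw [nearPotential, Finset.sum_eq_single_of_mem c hc, if_pos hwc]
    · exact h c hc hwc
    · intro c' hc' hne
      refine if_neg fun hwc' => ?_
      have h1 := hk.separated_succ n hc' hc hne
      have h2 := norm_sub_le_norm_sub_add_norm_sub c' w c
      rw [norm_sub_rev c' w] at h2
      linarith
  · push Not at hex
    rw [nearPotential, Finset.sum_eq_zero, norm_zero]
    · exact hB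
    · exact fun c hc => if_neg (not_lt.2 (hex c hc))

end IsAdmissible

/-- The point `w` is in a slight enlargement of one of the discs at level `n`. -/
def NearLevel (k : ℕ → ℕ) (n : ℕ) (w : ℂ) : Prop :=
  ∃ c ∈ levelCenters k n, ‖w - c‖ ≤ levelRadius k n * (1 + (1 / 2) ^ n)

namespace IsAdmissible

variable {k : ℕ → ℕ}

theorem nearLevel_of_succ (hk : IsAdmissible k) {n : ℕ} {w : ℂ} (h : NearLevel k (n + 1) w) :
    NearLevel k n w := by
  obtain ⟨x, hx, hwx⟩ := h
  obtain ⟨c, hc, s, hs, rfl⟩ := mem_levelCenters_succ.1 hx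
  refine ⟨c, hc, ?_⟩
  have h1 := hk.norm_grid_mul_le hs
  have h2 := norm_add_le (w - (c + levelRadius k n * s)) (levelRadius k n * s)
  rw [show w - (c + levelRadius k n * s) + levelRadius k n * s = w - c by ring] at h2
  have h3 : (1 / 2 : ℝ) ^ (n + 1) ≤ 1 := pow_le_one₀ (by norm_num) (by norm_num)
  have h4 : (0 : ℝ) < (1 / 2) ^ n := by positivity
  nlinarith [hk.levelRadius_pos n, hk.levelRadius_pos (n + 1)]

theorem norm_nearPotential_le_one (hk : IsAdmissible k) (n : ℕ) (w : ℂ) :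
    ‖nearPotential k n w‖ ≤ 1 :=
  hk.norm_nearPotential_le zero_le_one fun _ _ _ => norm_discPotential_one_le_one _

/-- The only possible nearby disc is the one whose enlargement contains w, and there the potential
nearly vanishes. -/
theorem norm_nearPotential_le_of_near (hk : IsAdmissible k) {n : ℕ} {w : ℂ}
    (h : NearLevel k (n + 1) w) : ‖nearPotential k n w‖ ≤ (1 / 2) ^ n := by
  obtain ⟨c, hc, hwc⟩ := h
  refine hk.norm_nearPotential_le (by positivity) fun c' hc' hwc' => ?_
  have hR := hk.levelRadius_pos (n + 1)
  have hcc : c' = c := by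
    by_contra hne
    have h1 := hk.separated_succ n hc' hc hne
    have h2 := norm_sub_le_norm_sub_add_norm_sub c' w c
    rw [norm_sub_rev c' w] at h2
    have h3 : (1 / 2 : ℝ) ^ (n + 1) ≤ 1 := pow_le_one₀ (by norm_num) (by norm_num)
    nlinarith [hk.twenty_mul_levelRadius_succ_le n]
  subst hcc
  refine (norm_discPotential_one_le (δ := (1 / 2) ^ (n + 1)) (by positivity) ?_).trans
    (le_of_eq (by ring))
  rw [norm_div, Complex.norm_real, Real.norm_of_nonneg hR.le, div_le_iff₀ hR, mul_comm]
  exact hwc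

/-- Here w is at distance at least 2⁻ⁿ Rₙ from every new centre, so the decay 1/|z| and the
smallness of the new radius give the bound. -/
theorem norm_nearPotential_le_of_not_near (hk : IsAdmissible k) {n : ℕ} {w : ℂ}
    (h : ¬ NearLevel k n w) : ‖nearPotential k n w‖ ≤ (1 / 2) ^ n := by
  refine hk.norm_nearPotential_le (by positivity) fun x hx _ => ?_
  obtain ⟨c, hc, s, hs, rfl⟩ := mem_levelCenters_succ.1 hx
  have hR := hk.levelRadius_pos (n + 1)
  have h1 := hk.norm_grid_mul_le hs
  have h2 := norm_add_le (w - (c + levelRadius k n * s)) (levelRadius k n * s)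
  rw [show w - (c + levelRadius k n * s) + levelRadius k n * s = w - c by ring] at h2
  have h3 : levelRadius k n * (1 + (1 / 2) ^ n) < ‖w - c‖ := by
    by_contra h'
    exact h ⟨c, hc, not_lt.1 h'⟩
  have h4 : levelRadius k n * (1 / 2) ^ n ≤ ‖w - (c + levelRadius k n * s)‖ := by linarith
  have h5 := hk.levelRadius_succ_le n
  have h6 := hk.levelRadius_pos n
  have h7 : 0 < ‖w - (c + levelRadius k n * s)‖ := lt_of_lt_of_le (by positivity) h4
  refine (norm_discPotential_le zero_le_one _).trans ?_
  rw [norm_div, Complex.norm_real, Real.norm_of_nonneg hR.le, inv_div, div_le_iff₀ h7]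
  refine h5.trans ?_
  rw [mul_comm _ (levelRadius k n)]
  gcongr

-- The indicator pays for the single large step: it drops from 1 to 0 exactly when w leaves the
-- neighbourhood of the discs, and it can never return to 1. The error 2 · 2⁻ⁿ collects the lattice
-- error and the small near term.
open Classical in
theorem norm_levelPotential_succ_le (hk : IsAdmissible k) (n : ℕ) (w : ℂ) :
    ‖levelPotential k (n + 1) w‖ + (if NearLevel k (n + 1) w then 1 else 0)
      ≤ ‖levelPotential k n w‖ + (if NearLevel k n w then 1 else 0) + 2 * (1 / 2) ^ n := by
  have h1 := hk.levelPotential_succ_sub n w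
  have h2 : ‖∑ c ∈ levelCenters k n, (gridPotential (k n) ((w - c) / levelRadius k n)
      - discPotential 1 ((w - c) / levelRadius k n))‖ ≤ (1 / 2) ^ n := by
    refine (norm_sum_le_of_le (levelCenters k n) (f := fun c =>
      gridPotential (k n) ((w - c) / levelRadius k n)
      - discPotential 1 ((w - c) / levelRadius k n))
      (n := fun _ => (1 / 2) ^ n * levelRadius k n) fun c _ => ?_).trans ?_
    · rw [norm_sub_rev]
      exact hk.norm_sub_le n _
    · rw [Finset.sum_const, hk.card_levelCenters, nsmul_eq_mul, levelRadius]
      have : (levelCard k n : ℝ) ≠ 0 := by exact_mod_cast (hk.levelCard_pos n).ne'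
      field_simp
      rfl
  have h3 : ‖levelPotential k (n + 1) w‖ ≤ ‖levelPotential k n w‖ + (1 / 2) ^ n
      + ‖nearPotential k n w‖ := by
    rw [sub_eq_iff_eq_add] at h1
    rw [h1]
    refine (norm_add₃_le).trans ?_
    linarith
  by_cases hn : NearLevel k n w
  · by_cases hn1 : NearLevel k (n + 1) w
    · rw [if_pos hn, if_pos hn1]
      linarith [hk.norm_nearPotential_le_of_near hn1]
    · rw [if_pos hn, if_neg hn1]
      linarith [hk.norm_nearPotential_le_one n w, show (0 : ℝ) < (1 / 2) ^ n by positivity]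
  · rw [if_neg hn, if_neg fun h => hn (hk.nearLevel_of_succ h)]
    linarith [hk.norm_nearPotential_le_of_not_near hn]

theorem norm_levelPotential_le (hk : IsAdmissible k) (n : ℕ) (w : ℂ) :
    ‖levelPotential k n w‖ ≤ 6 := by
  classical
  -- The term 4 · 2⁻ⁿ is the sum of all errors still to come; at level 0 the bound is 1 + 1 + 4.
  have h : ‖levelPotential k n w‖ + (if NearLevel k n w then 1 else 0) + 4 * (1 / 2) ^ n
      ≤ 6 := by
    induction n with
    | zero =>
      have h1 : ‖levelPotential k 0 w‖ ≤ 1 := by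
        rw [hk.levelPotential_eq_sum]
        simpa [levelCenters, levelRadius_zero] using norm_discPotential_one_le_one w
      have h2 : (if NearLevel k 0 w then (1 : ℝ) else 0) ≤ 1 := by split_ifs <;> norm_num
      rw [pow_zero]
      linarith
    | succ n ih =>
      have := hk.norm_levelPotential_succ_le n w
      rw [pow_succ]
      linarith
  have h1 : (0 : ℝ) ≤ if NearLevel k n w then 1 else 0 := by split_ifs <;> norm_num
  linarith [show (0 : ℝ) < (1 / 2) ^ n by positivity]

end IsAdmissible

/-! ### The Cantor set and its measure -/

/-- The union of the discs at level `n`. -/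
def levelSet (k : ℕ → ℕ) (n : ℕ) : Set ℂ :=
  ⋃ c ∈ levelCenters k n, Metric.closedBall c (levelRadius k n)

/-- The `n`-th partial sum of the series `∑ R_i ω_i`. -/
noncomputable def levelSum (k : ℕ → ℕ) (n : ℕ) (ω : ∀ i, grid (k i)) : ℂ :=
  ∑ i ∈ Finset.range n, levelRadius k i * (ω i : ℂ)

theorem isClosed_levelSet (k : ℕ → ℕ) (n : ℕ) : IsClosed (levelSet k n) :=
  isClosed_biUnion_finset fun _ _ => Metric.isClosed_closedBall

namespace IsAdmissible

variable {k : ℕ → ℕ}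

theorem _root_.levelSum_mem (n : ℕ) (ω : ∀ i, grid (k i)) :
    levelSum k n ω ∈ levelCenters k n := by
  induction n with
  | zero => simp [levelSum, levelCenters]
  | succ n ih =>
    rw [levelSum, Finset.sum_range_succ, mem_levelCenters_succ]
    exact ⟨_, ih, _, (ω n).2, rfl⟩

theorem nonempty_grid (hk : IsAdmissible k) (n : ℕ) : Nonempty (grid (k n)) :=
  Finset.nonempty_coe_sort.2 (Finset.card_pos.1 (Nat.cast_pos.1 (hk.card_pos n)))

theorem exists_levelSum_eq (hk : IsAdmissible k) (n : ℕ) :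
    ∀ c ∈ levelCenters k n, ∃ ω, levelSum k n ω = c := by
  induction n with
  | zero =>
    exact fun c hc => ⟨fun i => (hk.nonempty_grid i).some, by simp_all [levelSum, levelCenters]⟩
  | succ n ih =>
    intro x hx
    obtain ⟨c, hc, s, hs, rfl⟩ := mem_levelCenters_succ.1 hx
    obtain ⟨ω, rfl⟩ := ih c hc
    refine ⟨Function.update ω n ⟨s, hs⟩, ?_⟩
    rw [levelSum, Finset.sum_range_succ, levelSum]
    congr 1
    · refine Finset.sum_congr rfl fun i hi => ?_
      rw [Function.update_of_ne (Finset.mem_range.1 hi).ne]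
    · rw [Function.update_self]

theorem norm_levelSum_sub_le (hk : IsAdmissible k) (ω : ∀ i, grid (k i)) {n m : ℕ} (h : n ≤ m) :
    ‖levelSum k m ω - levelSum k n ω‖ + levelRadius k m ≤ levelRadius k n := by
  induction m, h using Nat.le_induction with
  | base => simp
  | succ m _ ih =>
    have h1 := hk.norm_grid_mul_le (ω m).2
    have h2 : levelSum k (m + 1) ω - levelSum k n ω
        = (levelSum k m ω - levelSum k n ω) + levelRadius k m * (ω m : ℂ) := by
      rw [levelSum, Finset.sum_range_succ, ← levelSum]; ring
    rw [h2]
    linarith [norm_add_le (levelSum k m ω - levelSum k n ω) (levelRadius k m * (ω m : ℂ)),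
      hk.levelRadius_pos (m + 1)]

theorem tendsto_levelRadius (hk : IsAdmissible k) :
    Filter.Tendsto (levelRadius k) Filter.atTop (nhds 0) :=
  squeeze_zero (fun n => (hk.levelRadius_pos n).le) hk.levelRadius_le
    (tendsto_pow_atTop_nhds_zero_of_lt_one (by norm_num) (by norm_num))

theorem tendsto_levelSum (hk : IsAdmissible k) (ω : ∀ i, grid (k i)) :
    Filter.Tendsto (fun n => levelSum k n ω) Filter.atTop
      (nhds (∑' i, levelRadius k i * (ω i : ℂ))) := by
  have h : Summable fun i => levelRadius k i * (ω i : ℂ) := by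
    refine Summable.of_norm_bounded (summable_geometric_two) fun i => ?_
    linarith [hk.norm_grid_mul_le (ω i).2, hk.levelRadius_pos (i + 1), hk.levelRadius_le i]
  exact h.hasSum.tendsto_sum_nat

theorem tsum_mem_closedBall (hk : IsAdmissible k) (ω : ∀ i, grid (k i)) (n : ℕ) :
    ∑' i, levelRadius k i * (ω i : ℂ) ∈ Metric.closedBall (levelSum k n ω) (levelRadius k n) := by
  refine Metric.isClosed_closedBall.mem_of_tendsto (hk.tendsto_levelSum ω) ?_
  filter_upwards [Filter.eventually_ge_atTop n] with m hm
  rw [mem_closedBall_iff_norm]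
  linarith [hk.norm_levelSum_sub_le ω hm, hk.levelRadius_pos m]

theorem pairwiseDisjoint_closedBall (hk : IsAdmissible k) (n : ℕ) :
    (levelCenters k n : Set ℂ).PairwiseDisjoint
      fun c => Metric.closedBall c (levelRadius k n) := by
  intro c hc c' hc' hne
  refine Metric.closedBall_disjoint_closedBall ?_
  rw [dist_eq_norm]
  linarith [hk.separated n c hc c' hc' hne, hk.levelRadius_pos n]

/-- The measure is the law of ∑ Rᵢ ωᵢ with independent uniform digits ωᵢ. Fixing the first n digits
has probability Rₙ and confines the sum to one disc of level n. -/
theorem exists_measure_closedBall_ge (hk : IsAdmissible k) :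
    ∃ μ : Measure ℂ, IsProbabilityMeasure μ ∧
      ∀ n, ∀ c ∈ levelCenters k n,
        levelRadius k n ≤ μ.real (Metric.closedBall c (levelRadius k n)) := by
  have := hk.nonempty_grid
  let P : Measure (∀ i, grid (k i)) :=
    Measure.infinitePi fun i => (PMF.uniformOfFintype (grid (k i))).toMeasure
  let X : (∀ i, grid (k i)) → ℂ := fun ω => ∑' i, levelRadius k i * (ω i : ℂ)
  have hX : Measurable X := by
    refine measurable_of_tendsto_metrizable (f := fun n ω => levelSum k n ω) (fun n => ?_)
      (tendsto_pi_nhds.2 fun ω => hk.tendsto_levelSum ω)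
    refine Finset.measurable_fun_sum _ fun i _ => ?_
    exact (measurable_subtype_coe.comp (measurable_pi_apply i)).const_mul _
  refine ⟨P.map X, Measure.isProbabilityMeasure_map hX.aemeasurable, fun n c hc => ?_⟩
  obtain ⟨ω, rfl⟩ := hk.exists_levelSum_eq n c hc
  have hP : P ((Finset.range n : Set ℕ).pi fun i => {ω i}) = ENNReal.ofReal (levelRadius k n) := by
    rw [Measure.infinitePi_pi _ fun i _ => measurableSet_singleton _, levelRadius, levelCard,
      Nat.cast_prod, ← Finset.prod_inv_distrib, ENNReal.ofReal_prod_of_nonneg (by simp)]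
    refine Finset.prod_congr rfl fun i _ => ?_
    rw [PMF.toMeasure_apply_singleton _ _ (measurableSet_singleton _), PMF.uniformOfFintype_apply,
      ENNReal.ofReal_inv_of_pos (hk.card_pos i), ENNReal.ofReal_natCast, Fintype.card_coe]
  have hsub : ((Finset.range n : Set ℕ).pi fun i => {ω i})
      ⊆ X ⁻¹' Metric.closedBall (levelSum k n ω) (levelRadius k n) := by
    intro ω' hω'
    have : levelSum k n ω' = levelSum k n ω := by
      refine Finset.sum_congr rfl fun i hi => ?_
      rw [hω' i hi]
    rw [← this]
    exact hk.tsum_mem_closedBall ω' n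
  rw [map_measureReal_apply hX Metric.isClosed_closedBall.measurableSet]
  refine le_trans (le_of_eq ?_) (measureReal_mono hsub)
  rw [measureReal_def, hP, ENNReal.toReal_ofReal (hk.levelRadius_pos n).le]

theorem sum_levelRadius (hk : IsAdmissible k) (n : ℕ) :
    ∑ _c ∈ levelCenters k n, levelRadius k n = 1 := by
  rw [Finset.sum_const, hk.card_levelCenters, nsmul_eq_mul, levelRadius, mul_inv_cancel₀]
  exact_mod_cast (hk.levelCard_pos n).ne'

/-- The uniform probability measure on the Cantor set. -/
theorem exists_measure_closedBall_eq (hk : IsAdmissible k) :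
    ∃ μ : Measure ℂ, IsProbabilityMeasure μ ∧
      (∀ n, ∀ c ∈ levelCenters k n,
        μ.real (Metric.closedBall c (levelRadius k n)) = levelRadius k n) ∧
      ∀ n, ∀ᵐ ξ ∂μ, ξ ∈ levelSet k n := by
  obtain ⟨μ, hμ, h⟩ := hk.exists_measure_closedBall_ge
  have hun : ∀ n, μ.real (levelSet k n)
      = ∑ c ∈ levelCenters k n, μ.real (Metric.closedBall c (levelRadius k n)) := fun n =>
    measureReal_biUnion_finset (hk.pairwiseDisjoint_closedBall n)
      fun c _ => Metric.isClosed_closedBall.measurableSet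
  have heq : ∀ n, ∀ c ∈ levelCenters k n,
      μ.real (Metric.closedBall c (levelRadius k n)) = levelRadius k n := by
    intro n c hc
    -- The discs are disjoint and the lower bounds already add up to 1, so none can be strict.
    refine le_antisymm (not_lt.1 fun hlt => ?_) (h n c hc)
    have h1 := Finset.sum_lt_sum (h n) ⟨c, hc, hlt⟩
    rw [hk.sum_levelRadius, ← hun] at h1
    exact absurd h1 (not_lt.2 measureReal_le_one)
  refine ⟨μ, hμ, heq, fun n => ?_⟩
  have h1 : μ.real (levelSet k n) = 1 := by
    rw [hun, Finset.sum_congr rfl (heq n), hk.sum_levelRadius]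
  rw [measureReal_def, ENNReal.toReal_eq_one_iff] at h1
  exact (prob_compl_eq_zero_iff (isClosed_levelSet k n).measurableSet).2 h1

end IsAdmissible

/-! ### Support, Hausdorff measure and pure unrectifiability -/

/-- A function whose values at the points of a finite set of times are `d`-separated has
variation at least `d` times the number of gaps. -/
theorem card_sub_one_mul_le_eVariationOn {γ : ℝ → ℂ} {I : Set ℝ} {A : Finset ℝ} (hA : ↑A ⊆ I)
    {d : ENNReal} (hd : ∀ s ∈ A, ∀ t ∈ A, s ≠ t → d ≤ edist (γ s) (γ t)) :
    ((A.card - 1 : ℕ) : ENNReal) * d ≤ eVariationOn γ I := by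
  rcases Nat.eq_zero_or_pos A.card with h0 | hpos
  · simp [h0]
  obtain ⟨m, hm⟩ : ∃ m, A.card = m + 1 := ⟨A.card - 1, by omega⟩
  let e := A.orderEmbOfFin hm
  -- The increasing enumeration of `A`, frozen after its last element to be monotone on all of ℕ.
  let u : ℕ → ℝ := fun i => e ⟨min i m, by omega⟩
  have hu : Monotone u := fun i j hij => e.monotone (by
    simp only [Fin.mk_le_mk]; omega)
  have hmem : ∀ i, u i ∈ A := fun i => A.orderEmbOfFin_mem hm _
  refine le_trans ?_ (eVariationOn.sum_le (f := γ) (n := m) hu fun i => hA (hmem i))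
  calc ((A.card - 1 : ℕ) : ENNReal) * d = ∑ _i ∈ Finset.range m, d := by
        rw [Finset.sum_const, Finset.card_range, nsmul_eq_mul, hm, Nat.add_sub_cancel]
    _ ≤ _ := by
        refine Finset.sum_le_sum fun i hi => hd _ (hmem _) _ (hmem _) fun h => ?_
        have h1 := e.injective h
        simp only [Fin.mk.injEq] at h1
        have := Finset.mem_range.1 hi
        omega

namespace IsAdmissible

variable {k : ℕ → ℕ}

theorem levelSet_succ_subset (hk : IsAdmissible k) (n : ℕ) :
    levelSet k (n + 1) ⊆ levelSet k n := by
  intro ξ hξ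
  simp only [levelSet, mem_iUnion, exists_prop] at hξ ⊢
  obtain ⟨x, hx, hξx⟩ := hξ
  obtain ⟨c, hc, s, hs, rfl⟩ := mem_levelCenters_succ.1 hx
  refine ⟨c, hc, ?_⟩
  rw [mem_closedBall_iff_norm] at hξx ⊢
  have h1 := hk.norm_grid_mul_le hs
  have h2 := norm_add_le (ξ - (c + levelRadius k n * s)) (levelRadius k n * s)
  rw [show ξ - (c + levelRadius k n * s) + levelRadius k n * s = ξ - c by ring] at h2
  linarith [hk.levelRadius_pos (n + 1)]

/-- Every neighbourhood of a point of the intersection contains a whole disc of some level, and that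
disc has positive mass. -/
theorem support_eq (hk : IsAdmissible k) {μ : Measure ℂ}
    (hball : ∀ n, ∀ c ∈ levelCenters k n,
      μ.real (Metric.closedBall c (levelRadius k n)) = levelRadius k n)
    (hae : ∀ n, ∀ᵐ ξ ∂μ, ξ ∈ levelSet k n) : μ.support = ⋂ n, levelSet k n := by
  refine Subset.antisymm (subset_iInter fun n =>
    Measure.support_subset_of_isClosed (isClosed_levelSet k n) (hae n)) fun x hx => ?_
  rw [Measure.mem_support_iff_forall]
  intro U hU
  obtain ⟨ε, hε, hεU⟩ := Metric.mem_nhds_iff.1 hU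
  obtain ⟨n, hn⟩ := (hk.tendsto_levelRadius.eventually_lt_const (half_pos hε)).exists
  have hxn := mem_iInter.1 hx n
  simp only [levelSet, mem_iUnion, exists_prop] at hxn
  obtain ⟨c, hc, hxc⟩ := hxn
  have hsub : Metric.closedBall c (levelRadius k n) ⊆ U := by
    refine Subset.trans (fun y hy => ?_) hεU
    rw [Metric.mem_closedBall] at hxc hy
    rw [Metric.mem_ball]
    linarith [dist_triangle_right y x c]
  refine lt_of_lt_of_le ?_ (measure_mono hsub)
  have h1 := hball n c hc
  have h2 := hk.levelRadius_pos n
  rw [← h1, measureReal_def] at h2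
  exact (ENNReal.toReal_pos_iff.1 h2).1

open Filter in
theorem hausdorffMeasure_le (hk : IsAdmissible k) {E : Set ℂ} (T : ℕ → Finset ℂ) (b : ℕ → ℝ)
    (hE : ∀ n, E ⊆ ⋃ c ∈ T n, Metric.closedBall c (levelRadius k (n + 1)))
    (hb : ∀ n, (T n).card * (2 * levelRadius k (n + 1)) ≤ b n) :
    Measure.hausdorffMeasure 1 E ≤ liminf (fun n => ENNReal.ofReal (b n)) atTop := by
  have hdiam : ∀ n (c : ℂ), Metric.ediam (Metric.closedBall c (levelRadius k (n + 1)))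
      ≤ ENNReal.ofReal (2 * levelRadius k (n + 1)) := by
    intro n c
    refine Metric.ediam_le fun x hx y hy => ?_
    rw [edist_dist]
    refine ENNReal.ofReal_le_ofReal ?_
    rw [Metric.mem_closedBall] at hx hy
    linarith [dist_triangle_right x y c]
  have htend : Tendsto (fun n => ENNReal.ofReal (2 * levelRadius k (n + 1))) atTop (nhds 0) := by
    have := (hk.tendsto_levelRadius.comp (tendsto_add_atTop_nat 1)).const_mul 2
    rw [mul_zero] at this
    simpa using! ENNReal.tendsto_ofReal this
  refine (Measure.hausdorffMeasure_le_liminf_sum (ι := fun n => T n) 1 E _ htend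
    (fun n c => Metric.closedBall (c : ℂ) (levelRadius k (n + 1)))
    (Eventually.of_forall fun n c => hdiam n c)
    (Eventually.of_forall fun n => (hE n).trans fun x hx => ?_)).trans ?_
  · simp only [mem_iUnion, exists_prop] at hx ⊢
    obtain ⟨c, hc, hx⟩ := hx
    exact ⟨⟨c, hc⟩, hx⟩
  · refine liminf_le_liminf (Eventually.of_forall fun n => ?_)
    calc ∑ c : T n, Metric.ediam (Metric.closedBall (c : ℂ) (levelRadius k (n + 1))) ^ (1 : ℝ)
        ≤ ∑ _c : T n, ENNReal.ofReal (2 * levelRadius k (n + 1)) :=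
          Finset.sum_le_sum fun c _ => by
            rw [ENNReal.rpow_one]
            exact hdiam n c
      _ = ENNReal.ofReal ((T n).card * (2 * levelRadius k (n + 1))) := by
          rw [Finset.sum_const, Finset.card_univ, Fintype.card_coe, nsmul_eq_mul,
            ENNReal.ofReal_mul (Nat.cast_nonneg _), ENNReal.ofReal_natCast]
      _ ≤ _ := ENNReal.ofReal_le_ofReal (hb n)

theorem hausdorffMeasure_iInter_lt_top (hk : IsAdmissible k) :
    Measure.hausdorffMeasure 1 (⋂ n, levelSet k n) < ⊤ := by
  refine (hk.hausdorffMeasure_le (fun n => levelCenters k (n + 1)) (fun _ => 2)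
    (fun n => iInter_subset _ (n + 1)) fun n => ?_).trans_lt ?_
  · have := hk.sum_levelRadius (n + 1)
    rw [Finset.sum_const, nsmul_eq_mul] at this
    linarith
  · rw [Filter.liminf_const]
    exact ENNReal.ofReal_lt_top

-- A curve of length L meets at most 1 + L/(2ⁿ Rₙ₊₁) discs of level n + 1, because points in
-- distinct discs are at least 2ⁿ Rₙ₊₁ apart. The total diameter of these discs tends to 0.
open Filter in
theorem isPurelyUnrectifiableSet_iInter (hk : IsAdmissible k) :
    IsPurelyUnrectifiableSet (⋂ n, levelSet k n) := by
  classical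
  rintro Γ ⟨a, b, γ, -, -, hvar, rfl⟩
  set L : ℝ := (eVariationOn γ (Icc a b)).toReal with hL
  have hL0 : 0 ≤ L := ENNReal.toReal_nonneg
  let T : ℕ → Finset ℂ := fun n => (levelCenters k (n + 1)).filter fun c =>
    ∃ t ∈ Icc a b, γ t ∈ Metric.closedBall c (levelRadius k (n + 1))
  have hcard : ∀ n, (T n).card * (2 * levelRadius k (n + 1))
      ≤ 2 * levelRadius k (n + 1) + 2 * L * (1 / 2) ^ n := by
    intro n
    have hR := hk.levelRadius_pos (n + 1)
    -- The 2 absorbs the two radii lost in passing from centres to points of the discs.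
    have hk2 : (2 : ℝ) ^ n ≤ k n - 2 := by
      have := hk.le n
      have h2 : ((20 + 2 ^ n : ℕ) : ℝ) ≤ k n := by exact_mod_cast this
      push_cast at h2
      linarith
    have hex : ∀ c : ℂ, ∃ t, c ∈ T n →
        t ∈ Icc a b ∧ γ t ∈ Metric.closedBall c (levelRadius k (n + 1)) := by
      intro c
      by_cases hc : c ∈ T n
      · obtain ⟨t, h1, h2⟩ := (Finset.mem_filter.1 hc).2
        exact ⟨t, fun _ => ⟨h1, h2⟩⟩
      · exact ⟨0, fun h => absurd h hc⟩
    choose τ hτ using hex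
    have hsep : ∀ c ∈ T n, ∀ c' ∈ T n, c ≠ c' →
        2 ^ n * levelRadius k (n + 1) ≤ dist (γ (τ c)) (γ (τ c')) := by
      intro c hc c' hc' hne
      have h1 := (hk.mul_levelRadius_succ_le n).trans (hk.separated_succ n
        (Finset.mem_filter.1 hc).1 (Finset.mem_filter.1 hc').1 hne)
      have h2 := (hτ c hc).2
      have h3 := (hτ c' hc').2
      rw [Metric.mem_closedBall] at h2 h3
      rw [← dist_eq_norm] at h1
      have h4 := dist_triangle4 c (γ (τ c)) (γ (τ c')) c'
      rw [dist_comm c (γ (τ c))] at h4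
      nlinarith
    have hinj : InjOn τ (T n) := by
      intro c hc c' hc' h
      by_contra hne
      have h1 := hsep c hc c' hc' hne
      rw [h, dist_self] at h1
      exact absurd h1 (not_le.2 (by positivity))
    have key := card_sub_one_mul_le_eVariationOn (γ := γ) (I := Icc a b) (A := (T n).image τ)
      (d := ENNReal.ofReal (2 ^ n * levelRadius k (n + 1))) (by
        intro t ht
        obtain ⟨c, hc, rfl⟩ := Finset.mem_image.1 (Finset.mem_coe.1 ht)
        exact (hτ c hc).1) (by
        intro s hs t ht hst
        obtain ⟨c, hc, rfl⟩ := Finset.mem_image.1 hs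
        obtain ⟨c', hc', rfl⟩ := Finset.mem_image.1 ht
        rw [edist_dist]
        exact ENNReal.ofReal_le_ofReal (hsep c hc c' hc' fun h => hst (by rw [h])))
    rw [Finset.card_image_of_injOn hinj] at key
    have key2 : (((T n).card - 1 : ℕ) : ℝ) * (2 ^ n * levelRadius k (n + 1)) ≤ L := by
      have := ENNReal.toReal_mono hvar.ne key
      rwa [ENNReal.toReal_mul, ENNReal.toReal_natCast, ENNReal.toReal_ofReal (by positivity)]
        at this
    have h5 : ((T n).card : ℝ) ≤ (((T n).card - 1 : ℕ) : ℝ) + 1 := by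
      exact_mod_cast (by omega : (T n).card ≤ (T n).card - 1 + 1)
    have h6 : (((T n).card - 1 : ℕ) : ℝ) * levelRadius k (n + 1) ≤ L * (1 / 2) ^ n := by
      rw [one_div, inv_pow, ← div_eq_mul_inv, le_div_iff₀ (by positivity)]
      linarith
    nlinarith
  have hcover : ∀ n, γ '' Icc a b ∩ (⋂ n, levelSet k n)
      ⊆ ⋃ c ∈ T n, Metric.closedBall c (levelRadius k (n + 1)) := by
    rintro n ξ ⟨⟨t, ht, rfl⟩, hξ⟩
    have h1 := mem_iInter.1 hξ (n + 1)
    simp only [levelSet, mem_iUnion, exists_prop] at h1 ⊢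
    obtain ⟨c, hc, h2⟩ := h1
    exact ⟨c, Finset.mem_filter.2 ⟨hc, t, ht, h2⟩, h2⟩
  have hlim : Tendsto (fun n => ENNReal.ofReal (2 * levelRadius k (n + 1) + 2 * L * (1 / 2) ^ n))
      atTop (nhds 0) := by
    have h1 := (hk.tendsto_levelRadius.comp (tendsto_add_atTop_nat 1)).const_mul 2
    have h2 := (tendsto_pow_atTop_nhds_zero_of_lt_one (r := (1 / 2 : ℝ)) (by norm_num)
      (by norm_num)).const_mul (2 * L)
    have h3 := h1.add h2
    rw [mul_zero, mul_zero, add_zero] at h3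
    simpa using! ENNReal.tendsto_ofReal h3
  have := hk.hausdorffMeasure_le T _ hcover hcard
  rw [hlim.liminf_eq] at this
  exact le_antisymm this zero_le

/-! ### Linear growth of the measure -/

/-- Linear growth of the number of discs at level `n + 1` meeting a disc whose radius is
between the radii of the two levels. -/
theorem card_mul_levelRadius_le (hk : IsAdmissible k) {n : ℕ} {z : ℂ} {ρ : ℝ}
    (h1 : levelRadius k (n + 1) ≤ ρ) (h2 : ρ < levelRadius k n) {T : Finset ℂ}
    (hT : T ⊆ levelCenters k (n + 1)) (hTz : ∀ x ∈ T, ‖z - x‖ ≤ ρ + levelRadius k (n + 1)) :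
    T.card * levelRadius k (n + 1) ≤ 160 * ρ := by
  classical
  have hR := hk.levelRadius_pos n
  have hR' := hk.levelRadius_pos (n + 1)
  have hρ : 0 < ρ := hR'.trans_le h1
  rcases T.eq_empty_or_nonempty with rfl | ⟨x₀, hx₀⟩
  · simp; linarith
  obtain ⟨c₀, hc₀, s₀, hs₀, hx₀'⟩ := mem_levelCenters_succ.1 (hT hx₀)
  set σ : ℝ := (ρ + levelRadius k (n + 1)) / levelRadius k n with hσ
  have hσ0 : 0 ≤ σ := by positivity
  set u : ℂ := (z - c₀) / levelRadius k n with hu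
  have hRC : (levelRadius k n : ℂ) ≠ 0 := by exact_mod_cast hR.ne'
  have himage : T ⊆ ((grid (k n)).filter fun s => ‖u - s‖ ≤ σ).image
      fun s => c₀ + levelRadius k n * s := by
    intro x hx
    obtain ⟨c, hc, s, hs, rfl⟩ := mem_levelCenters_succ.1 (hT hx)
    -- As ρ < Rₙ, all discs counted descend from one parent: otherwise two parent centres would be
    -- closer than 4Rₙ.
    have hcc : c = c₀ := by
      by_contra hne
      have h3 := hk.separated n c hc c₀ hc₀ hne
      have h4 := hk.norm_grid_mul_le hs
      have h5 := hk.norm_grid_mul_le hs₀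
      have h6 := hTz _ hx
      have h7 := hTz _ hx₀
      rw [← hx₀'] at h7
      have h8 : ‖c - c₀‖ ≤ ‖z - (c₀ + levelRadius k n * s₀)‖ + ‖z - (c + levelRadius k n * s)‖
          + ‖levelRadius k n * s₀‖ + ‖levelRadius k n * s‖ := by
        calc ‖c - c₀‖ = ‖(z - (c₀ + levelRadius k n * s₀)) - (z - (c + levelRadius k n * s))
              + levelRadius k n * s₀ - levelRadius k n * s‖ := by congr 1; ring
          _ ≤ _ := by
              refine (_root_.norm_sub_le _ _).trans ?_
              gcongr
              refine (norm_add_le _ _).trans ?_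
              gcongr
              exact _root_.norm_sub_le _ _
      linarith
    subst hcc
    refine Finset.mem_image.2 ⟨s, Finset.mem_filter.2 ⟨hs, ?_⟩, rfl⟩
    have h3 := hTz _ hx
    have h4 : u - s = (z - (c + levelRadius k n * s)) / levelRadius k n := by
      rw [hu]; field_simp; ring
    rw [h4, norm_div, Complex.norm_real, Real.norm_of_nonneg hR.le, hσ]
    gcongr
  set S := (grid (k n)).filter fun s => ‖u - s‖ ≤ σ
  have hcard : (T.card : ℝ) ≤ S.card := by
    exact_mod_cast (Finset.card_le_card himage).trans Finset.card_image_le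
  have hS := card_filter_grid_le (hk.pos n) u hσ0 (Finset.filter_subset _ _ : S ⊆ grid (k n))
    fun s hs => (Finset.mem_filter.1 hs).2
  set ℓ : ℝ := (k n : ℝ)⁻¹ with hℓ
  obtain ⟨hN1, hN2⟩ := card_grid_bounds (hk.twenty_le n)
  have hk0 : (0 : ℝ) < k n := Nat.cast_pos.2 (hk.pos n)
  have hr1 : levelRadius k (n + 1) ≤ levelRadius k n * ℓ ^ 2 := by
    rw [levelRadius_succ, hℓ, inv_pow]
    gcongr
  have hr2 : levelRadius k n * ℓ ^ 2 ≤ 4 * levelRadius k (n + 1) := by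
    rw [levelRadius_succ, hℓ, inv_pow, mul_left_comm]
    gcongr
    rw [inv_eq_one_div, ← div_eq_mul_inv, div_le_div_iff₀ (by positivity) (hk.card_pos n)]
    linarith
  have hσR : levelRadius k n * σ ≤ 2 * ρ := by
    rw [hσ, mul_div_cancel₀ _ hR.ne']; linarith
  have hσ2 : σ ≤ 2 := by
    rw [hσ, div_le_iff₀ hR]; linarith
  have hRσ : levelRadius k n * σ ^ 2 ≤ 4 * ρ := by nlinarith
  calc T.card * levelRadius k (n + 1) ≤ S.card * (levelRadius k n * ℓ ^ 2) := by gcongr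
    _ = levelRadius k n * (S.card * ℓ ^ 2) := by ring
    _ ≤ levelRadius k n * (4 * (σ + 2 * ℓ) ^ 2) := by
        refine mul_le_mul_of_nonneg_left (hS.trans ?_) hR.le
        exact mul_le_mul_of_nonneg_right Real.pi_lt_four.le (sq_nonneg _)
    _ ≤ levelRadius k n * (4 * (2 * σ ^ 2 + 8 * ℓ ^ 2)) := by
        gcongr
        nlinarith [sq_nonneg (σ - 2 * ℓ)]
    -- 32ρ from Rₙσ² ≤ 4ρ, and 128ρ from Rₙℓ² ≤ 4Rₙ₊₁ ≤ 4ρ.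
    _ ≤ 160 * ρ := by linarith

theorem measure_closedBall_le (hk : IsAdmissible k) {μ : Measure ℂ} [IsProbabilityMeasure μ]
    (hball : ∀ n, ∀ c ∈ levelCenters k n,
      μ.real (Metric.closedBall c (levelRadius k n)) = levelRadius k n)
    (hae : ∀ n, ∀ᵐ ξ ∂μ, ξ ∈ levelSet k n) (z : ℂ) {ρ : ℝ} (hρ : 0 < ρ) :
    μ (Metric.closedBall z ρ) ≤ ENNReal.ofReal (160 * ρ) := by
  classical
  rw [← ofReal_measureReal]
  refine ENNReal.ofReal_le_ofReal ?_
  by_cases hρ1 : 1 ≤ ρ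
  · exact measureReal_le_one.trans (by linarith)
  have hex : ∃ n, levelRadius k n ≤ ρ :=
    (hk.tendsto_levelRadius.eventually_le_const hρ).exists
  -- Since ρ < 1 = R₀, the first level with radius at most ρ is not level 0.
  obtain ⟨n, hn⟩ : ∃ n, Nat.find hex = n + 1 := by
    refine Nat.exists_eq_succ_of_ne_zero fun h0 => hρ1 ?_
    have := Nat.find_spec hex
    rwa [h0, levelRadius_zero] at this
  have h1 : levelRadius k (n + 1) ≤ ρ := hn ▸ Nat.find_spec hex
  have h2 : ρ < levelRadius k n := not_le.1 (Nat.find_min hex (by omega))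
  set T := (levelCenters k (n + 1)).filter fun x => ‖z - x‖ ≤ ρ + levelRadius k (n + 1)
  refine le_trans ?_ (hk.card_mul_levelRadius_le h1 h2 (Finset.filter_subset _ _ : T ⊆ _)
    fun x hx => (Finset.mem_filter.1 hx).2)
  have hsub : Metric.closedBall z ρ ≤ᵐ[μ]
      (⋃ x ∈ T, Metric.closedBall x (levelRadius k (n + 1)) : Set ℂ) := by
    filter_upwards [hae (n + 1)] with ξ hξ hξz
    simp only [levelSet, mem_iUnion, exists_prop] at hξ
    obtain ⟨x, hx, hξx⟩ := hξ
    refine mem_iUnion₂.2 ⟨x, Finset.mem_filter.2 ⟨hx, ?_⟩, hξx⟩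
    have hξz : ξ ∈ Metric.closedBall z ρ := hξz
    rw [Metric.mem_closedBall] at hξx hξz
    rw [← dist_eq_norm]
    linarith [dist_triangle_left z x ξ]
  calc μ.real (Metric.closedBall z ρ)
      ≤ μ.real (⋃ x ∈ T, Metric.closedBall x (levelRadius k (n + 1))) :=
        ENNReal.toReal_mono (measure_ne_top _ _) (measure_mono_ae hsub)
    _ ≤ ∑ x ∈ T, μ.real (Metric.closedBall x (levelRadius k (n + 1))) :=
        measureReal_biUnion_finset_le _ _
    _ = T.card * levelRadius k (n + 1) := by
        rw [Finset.sum_congr rfl fun x hx => hball (n + 1) x (Finset.mem_filter.1 hx).1,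
          Finset.sum_const, nsmul_eq_mul]

/-! ### The singular integral off the support -/

theorem levelSet_antitone (hk : IsAdmissible k) : Antitone (levelSet k) :=
  antitone_nat_of_succ_le hk.levelSet_succ_subset

/-- A point off the support has distance d > 0 from all late levels. Replacing the measure on each
disc by its `discPotential` changes the kernel by O(Rₙ/d²), so for large n the integral is within 1
of the level potential, which is at most 6. -/
theorem norm_singularIntegral_le (hk : IsAdmissible k) {μ : Measure ℂ} [IsProbabilityMeasure μ]
    (hball : ∀ n, ∀ c ∈ levelCenters k n,
      μ.real (Metric.closedBall c (levelRadius k n)) = levelRadius k n)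
    (hae : ∀ n, ∀ᵐ ξ ∂μ, ξ ∈ levelSet k n) {w : ℂ} (hw : w ∉ ⋂ n, levelSet k n) :
    Integrable (fun ξ => tripleKernel (w - ξ)) μ ∧
      ‖singularIntegral tripleKernel μ (fun _ => 1) w‖ ≤ 7 := by
  simp only [mem_iInter, not_forall] at hw
  obtain ⟨n₀, hn₀⟩ := hw
  obtain ⟨d, hd, hdw⟩ := Metric.isOpen_iff.1 (isClosed_levelSet k n₀).isOpen_compl w hn₀
  have hfar : ∀ n, n₀ ≤ n → ∀ ξ ∈ levelSet k n, d ≤ ‖w - ξ‖ := by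
    intro n hn ξ hξ
    by_contra h
    refine hdw ?_ (hk.levelSet_antitone hn hξ)
    rw [Metric.mem_ball, dist_comm, dist_eq_norm]
    exact not_le.1 h
  have hmeas : Measurable fun ξ => tripleKernel (w - ξ) :=
    measurable_tripleKernel.comp (measurable_const.sub measurable_id)
  have hint : Integrable (fun ξ => tripleKernel (w - ξ)) μ := by
    refine Integrable.of_bound hmeas.aestronglyMeasurable d⁻¹ ?_
    filter_upwards [hae n₀] with ξ hξ
    rw [norm_tripleKernel]
    gcongr
    exact hfar n₀ le_rfl ξ hξ
  refine ⟨hint, ?_⟩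
  -- Rₙ < d puts w outside the discs, where the potential has its explicit form; Rₙ < d²/4 makes the
  -- total error 4Rₙ/d² at most 1.
  obtain ⟨n, hn, hRd, hRd2⟩ := ((Filter.eventually_ge_atTop n₀).and
    ((hk.tendsto_levelRadius.eventually_lt_const hd).and
    (hk.tendsto_levelRadius.eventually_lt_const (show 0 < d ^ 2 / 4 by positivity)))).exists
  have hR := hk.levelRadius_pos n
  have hself : ∀ c ∈ levelCenters k n, ∀ ξ ∈ Metric.closedBall c (levelRadius k n),
      ξ ∈ levelSet k n := fun c hc ξ hξ => mem_iUnion₂.2 ⟨c, hc, hξ⟩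
  have hclose : ∀ c ∈ levelCenters k n, ∀ ξ ∈ Metric.closedBall c (levelRadius k n),
      ‖tripleKernel (w - ξ) - discPotential (levelRadius k n) (w - c)‖ ≤ 1 := by
    intro c hc ξ hξ
    have hx := hfar n hn ξ (hself c hc ξ hξ)
    have hy := hfar n hn c (hself c hc c (Metric.mem_closedBall_self hR.le))
    have hx0 : 0 < ‖w - ξ‖ := hd.trans_le hx
    have hy0 : 0 < ‖w - c‖ := hd.trans_le hy
    have hxy : ‖(w - ξ) - (w - c)‖ ≤ levelRadius k n := by
      rw [sub_sub_sub_cancel_left, norm_sub_rev]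
      rwa [mem_closedBall_iff_norm] at hξ
    have h1 := norm_tripleKernel_sub_le (norm_pos_iff.1 hx0) (norm_pos_iff.1 hy0)
    have h2 := norm_discPotential_sub_tripleKernel hR.le (hRd.trans_le hy)
    have h3 : ‖(w - ξ) - (w - c)‖ * (2 * ‖w - c‖ + ‖w - ξ‖) / (‖w - ξ‖ ^ 2 * ‖w - c‖)
        ≤ 3 * levelRadius k n / d ^ 2 := by
      rw [div_le_div_iff₀ (by positivity) (by positivity)]
      have h4 : (2 * ‖w - c‖ + ‖w - ξ‖) * d ^ 2 ≤ 3 * (‖w - ξ‖ ^ 2 * ‖w - c‖) := by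
        have h5 : d ^ 2 ≤ ‖w - ξ‖ ^ 2 := by gcongr
        have h6 : d ^ 2 ≤ ‖w - ξ‖ * ‖w - c‖ := by
          rw [sq]; gcongr
        nlinarith
      calc _ = ‖(w - ξ) - (w - c)‖ * ((2 * ‖w - c‖ + ‖w - ξ‖) * d ^ 2) := by ring
        _ ≤ levelRadius k n * (3 * (‖w - ξ‖ ^ 2 * ‖w - c‖)) := by gcongr
        _ = _ := by ring
    have h4 : levelRadius k n ^ 2 / ‖w - c‖ ^ 3 ≤ levelRadius k n / d ^ 2 := by
      rw [div_le_div_iff₀ (by positivity) (by positivity)]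
      calc levelRadius k n ^ 2 * d ^ 2 = levelRadius k n * (levelRadius k n * d ^ 2) := by ring
        _ ≤ levelRadius k n * (‖w - c‖ * ‖w - c‖ ^ 2) := by
            gcongr
            linarith
        _ = _ := by ring
    have h5 : 4 * levelRadius k n / d ^ 2 ≤ 1 := by
      rw [div_le_one (by positivity)]
      linarith
    have h6 := norm_sub_le_norm_sub_add_norm_sub (tripleKernel (w - ξ)) (tripleKernel (w - c))
      (discPotential (levelRadius k n) (w - c))
    rw [norm_sub_rev (tripleKernel (w - c)), h2] at h6
    have h7 : 4 * levelRadius k n / d ^ 2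
        = 3 * levelRadius k n / d ^ 2 + levelRadius k n / d ^ 2 := by ring
    linarith
  have hsplit : singularIntegral tripleKernel μ (fun _ => 1) w
      = ∑ c ∈ levelCenters k n, ∫ ξ in Metric.closedBall c (levelRadius k n),
          tripleKernel (w - ξ) ∂μ := by
    simp only [singularIntegral, mul_one]
    rw [← integral_biUnion_finset _ (fun c _ => Metric.isClosed_closedBall.measurableSet)
      (hk.pairwiseDisjoint_closedBall n) fun c _ => hint.integrableOn]
    rw [← levelSet, Measure.restrict_eq_self_of_ae_mem (hae n)]
  have hF : levelPotential k n w = ∑ c ∈ levelCenters k n,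
      ∫ _ξ in Metric.closedBall c (levelRadius k n),
        discPotential (levelRadius k n) (w - c) ∂μ := by
    rw [levelPotential, Finset.mul_sum]
    refine Finset.sum_congr rfl fun c hc => ?_
    rw [setIntegral_const, hball n c hc, Complex.real_smul]
  have hdiff : ‖singularIntegral tripleKernel μ (fun _ => 1) w - levelPotential k n w‖ ≤ 1 := by
    rw [hsplit, hF, ← Finset.sum_sub_distrib, ← hk.sum_levelRadius n]
    refine norm_sum_le_of_le _ fun c hc => ?_
    rw [← integral_sub hint.integrableOn (integrableOn_const (measure_ne_top _ _))]
    refine (norm_setIntegral_le_of_norm_le_const (measure_lt_top _ _) (hclose c hc)).trans ?_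
    rw [hball n c hc, one_mul]
  have h1 := norm_sub_norm_le (singularIntegral tripleKernel μ (fun _ => 1) w)
    (levelPotential k n w)
  linarith [hk.norm_levelPotential_le n w]

end IsAdmissible

/-- There is a one-dimensional, purely unrectifiable probability measure `μ` on `ℂ` such that
`T_μ(1)`, for the kernel `conj z / z ^ 2`, is (given by convergent integrals and) bounded
on the complement of the closed support of `μ`. -/
theorem theorem1 :
    ∃ μ : Measure ℂ, IsProbabilityMeasure μ ∧ IsOneDimensional μ ∧ IsPurelyUnrectifiable μ ∧
      ∃ M : ℝ, ∀ z ∈ (μ.support)ᶜ,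
        Integrable (fun ξ => tripleKernel (z - ξ)) μ ∧
          ‖singularIntegral tripleKernel μ (fun _ => 1) z‖ ≤ M := by
  obtain ⟨k, hk⟩ := exists_isAdmissible
  obtain ⟨μ, hμ, hball, hae⟩ := hk.exists_measure_closedBall_eq
  have hsupp := hk.support_eq hball hae
  refine ⟨μ, hμ, ⟨inferInstance, ?_, 160, by norm_num, fun z r hr =>
    hk.measure_closedBall_le hball hae z hr⟩, ?_, 7, fun z hz => ?_⟩
  · rw [hsupp]
    exact hk.hausdorffMeasure_iInter_lt_top
  · rw [IsPurelyUnrectifiable, hsupp]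
    exact hk.isPurelyUnrectifiableSet_iInter
  · rw [hsupp] at hz
    exact hk.norm_singularIntegral_le hball hae hz
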